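/- Let $\mu>1$ and $0<\rho<1$. For an integer $N\ge 2$ put $\gamma=\gamma^N=\dfrac{\mu}{2\sin^2(\pi/N)}$, and for $x\in\mathbb R^{\mathbb Z/N\mathbb Z}$ let $$F_{\gamma,N}(x)=\sum_{i\in\mathbb Z/N\mathbb Z}\Big(\tfrac14x_i^4-\tfrac12x_i^2\Big)+\frac{\gamma}{4}\sum_{i\in\mathbb Z/N\mathbb Z}(x_i-x_{i+1})^2,\qquad G_{\gamma,N}=\tfrac1N F_{\gamma,N}.$$ Let $I_\pm=\pm(1,\dots,1)$, $O=(0,\dots,0)$, and let $B^N_\pm=B_{\rho\sqrt N}(I_\pm)$ be the open Euclidean balls of radius $\rho\sqrt N$ centred at $I_\pm$. For $\varepsilon>0$ and disjoint open sets $U,V\subset\mathbb R^N$, let $$\mathrm{cap}(U,V)=\inf_{h}\ \varepsilon\int_{(U\cup V)^c}e^{-G_{\gamma,N}(u)/\varepsilon}\,\|\nabla h(u)\|_2^2\,du$$ be the capacity associated with the diffusion $dX=-\nabla G_{\gamma,N}(X)\,dt+\sqrt{2\varepsilon}\,dB$, where the infimum is over all $h\in W^{1,2}(\mathbb R^N,e^{-G_{\gamma,N}(u)/\varepsilon}du)$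 with values in $[0,1]$, $h=1$ on $U$ and $h=0$ on $V$. Then there exist constants $A<\infty$ and $\varepsilon_0>0$, depending only on $\mu$ and $\rho$, such that for all $N\ge 2$ and all $0<\varepsilon<\varepsilon_0$, $$\frac{\mathrm{cap}(B^N_+,B^N_-)}{N^{N/2-1}}=\varepsilon\,\big(\sqrt{2\pi\varepsilon}\,\big)^{N-2}\,\frac{1}{\sqrt{|\det\nabla^2F_{\gamma,N}(O)|}}\,\big(1+R(\varepsilon,N)\big),\qquad |R(\varepsilon,N)|\le A\sqrt{\varepsilon\,|\ln\varepsilon|^3}.$$ -/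

import Mathlib

noncomputable section

namespace CoupledChain

open MeasureTheory

/-- The potential of a chain of `N` particles on the discrete circle `ℤ/Nℤ`, each in a
double well, with nearest-neighbour coupling `γ`. -/
def potential (N : ℕ) [NeZero N] (γ : ℝ) (x : EuclideanSpace ℝ (ZMod N)) : ℝ :=
  ∑ i : ZMod N, ((1 / 4) * x i ^ 4 - (1 / 2) * x i ^ 2) +
    (γ / 4) * ∑ i : ZMod N, (x i - x (i + 1)) ^ 2

/-- The rescaled potential `G = F / N`. -/
def rescaledPotential (N : ℕ) [NeZero N] (γ : ℝ) (x : EuclideanSpace ℝ (ZMod N)) : ℝ :=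
  (N : ℝ)⁻¹ * potential N γ x

/-- The synchronization threshold `1 / (2 sin² (π / N))` of the coupling constant. -/
def couplingThreshold (N : ℕ) : ℝ := 1 / (2 * Real.sin (Real.pi / N) ^ 2)

/-- The constant configuration `(a, …, a)`; `I_± = ±(1, …, 1)` are those with `a = ±1`. -/
def constConfig (N : ℕ) (a : ℝ) : EuclideanSpace ℝ (ZMod N) := WithLp.toLp 2 fun _ => a

/-- The Hessian matrix of `F` at `x` in the standard basis. -/
def hessianMatrix {ι : Type*} [Fintype ι] [DecidableEq ι] (F : EuclideanSpace ℝ ι → ℝ)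
    (x : EuclideanSpace ℝ ι) : Matrix ι ι ℝ :=
  Matrix.of fun i j =>
    iteratedFDeriv ℝ 2 F x ![EuclideanSpace.single i 1, EuclideanSpace.single j 1]

/-- The measure `e^{-V(u)/ε} du`. -/
def gibbsMeasure {ι : Type*} [Fintype ι] (V : EuclideanSpace ℝ ι → ℝ) (ε : ℝ) :
    Measure (EuclideanSpace ℝ ι) :=
  volume.withDensity fun u => ENNReal.ofReal (Real.exp (-V u / ε))

/-- `g` is the weak (distributional) gradient of `h` on `ℝ^ι`, with respect to Lebesgue measure. -/
structure IsWeakGradient {ι : Type*} [Fintype ι] (h : EuclideanSpace ℝ ι → ℝ)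
    (g : EuclideanSpace ℝ ι → EuclideanSpace ℝ ι) : Prop where
  locallyIntegrable : LocallyIntegrable h volume
  locallyIntegrable_grad : LocallyIntegrable g volume
  integral_eq : ∀ φ : EuclideanSpace ℝ ι → ℝ, ContDiff ℝ ((⊤ : ℕ∞) : WithTop ℕ∞) φ →
    HasCompactSupport φ → ∀ v : EuclideanSpace ℝ ι,
      ∫ u, h u * fderiv ℝ φ u v = -∫ u, φ u * inner ℝ (g u) v

/-- `h` lies in the class `ℋ` of test functions for the pair `(A, D)`: it belongs to the weighted
Sobolev space `W^{1,2}(ℝ^ι, e^{-V(u)/ε} du)`, with weak gradient `g`, takes values in `[0, 1]`,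
equals `1` on `A` and `0` on `D`. -/
structure IsAdmissible {ι : Type*} [Fintype ι] (V : EuclideanSpace ℝ ι → ℝ) (ε : ℝ)
    (A D : Set (EuclideanSpace ℝ ι)) (h : EuclideanSpace ℝ ι → ℝ)
    (g : EuclideanSpace ℝ ι → EuclideanSpace ℝ ι) : Prop where
  isWeakGradient : IsWeakGradient h g
  memLp : MemLp h 2 (gibbsMeasure V ε)
  memLp_grad : MemLp g 2 (gibbsMeasure V ε)
  mem_Icc : ∀ u, h u ∈ Set.Icc (0 : ℝ) 1
  eq_one : ∀ u ∈ A, h u = 1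
  eq_zero : ∀ u ∈ D, h u = 0

/-- The Dirichlet form `ε ∫_{(A ∪ D)ᶜ} e^{-V(u)/ε} ‖∇h(u)‖² du`, as a function of `g = ∇h`. -/
def dirichletForm {ι : Type*} [Fintype ι] (V : EuclideanSpace ℝ ι → ℝ) (ε : ℝ)
    (A D : Set (EuclideanSpace ℝ ι)) (g : EuclideanSpace ℝ ι → EuclideanSpace ℝ ι) : ℝ :=
  ε * ∫ u in (A ∪ D)ᶜ, Real.exp (-V u / ε) * ‖g u‖ ^ 2

/-- The capacity of the pair `(A, D)` for the reversible diffusion with generator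
`ε e^{V/ε} ∇ · (e^{-V/ε} ∇)`: the infimum of the Dirichlet form over `ℋ`. -/
def capacity {ι : Type*} [Fintype ι] (V : EuclideanSpace ℝ ι → ℝ) (ε : ℝ)
    (A D : Set (EuclideanSpace ℝ ι)) : ℝ :=
  sInf {c : ℝ | ∃ h g, IsAdmissible V ε A D h g ∧ c = dirichletForm V ε A D g}

end CoupledChain

end

noncomputable section

namespace CoupledChain

open MeasureTheory

section Gaussian

variable {ι : Type*} [Fintype ι]

open scoped MatrixOrder in
/-- A positive definite quadratic form is the squared norm of a linear image. -/
theorem exists_linearMap_norm_sq_eq [DecidableEq ι] {M : Matrix ι ι ℝ} (hM : M.PosDef) :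
    ∃ B : EuclideanSpace ℝ ι →ₗ[ℝ] EuclideanSpace ℝ ι,
      |LinearMap.det B| = √M.det ∧ ∀ u, ‖B u‖ ^ 2 = u.ofLp ⬝ᵥ (M.mulVec u.ofLp) := by
  set S := CFC.sqrt M with hS
  have hS0 : (0 : Matrix ι ι ℝ) ≤ S := CFC.sqrt_nonneg M
  have hSS : S * S = M := CFC.sqrt_mul_sqrt_self M hM.posSemidef.nonneg
  have hSt : S.transpose = S := by
    have := (Matrix.nonneg_iff_posSemidef.1 hS0).1
    rwa [Matrix.IsHermitian, Matrix.conjTranspose_eq_transpose_of_trivial] at this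
  refine ⟨Matrix.toLpLin 2 2 S, ?_, fun u => ?_⟩
  · have h1 : LinearMap.det (Matrix.toLpLin 2 2 S) = S.det := by
      rw [Matrix.toLpLin_eq_toLin]; simp
    rw [h1, ← hSS, Matrix.det_mul, Real.sqrt_mul_self_eq_abs]
  · rw [EuclideanSpace.real_norm_sq_eq]
    rw [← hSS, ← Matrix.mulVec_mulVec, Matrix.dotProduct_mulVec, ← Matrix.mulVec_transpose, hSt]
    simp [Matrix.toLpLin_apply, dotProduct, pow_two]

variable {B : EuclideanSpace ℝ ι →ₗ[ℝ] EuclideanSpace ℝ ι}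

theorem integrable_comp_linearMap_of_det_ne_zero (hB : LinearMap.det B ≠ 0)
    {f : EuclideanSpace ℝ ι → ℝ} (hf : Integrable f) : Integrable (fun u => f (B u)) := by
  have hc : Continuous B := B.continuous_of_finiteDimensional
  have h := Measure.map_linearMap_addHaar_eq_smul_addHaar
    (volume : Measure (EuclideanSpace ℝ ι)) hB
  have h1 : Integrable f (Measure.map B volume) := by
    rw [h]; exact hf.smul_measure ENNReal.ofReal_ne_top
  exact h1.comp_measurable hc.measurable

theorem integral_comp_linearMap_of_det_ne_zero [DecidableEq ι] (hB : LinearMap.det B ≠ 0)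
    (f : EuclideanSpace ℝ ι → ℝ) : ∫ u, f (B u) = |LinearMap.det B|⁻¹ * ∫ u, f u := by
  let e := (LinearEquiv.ofIsUnitDet (f := B) (v := (EuclideanSpace.basisFun ι ℝ).toBasis)
    (v' := (EuclideanSpace.basisFun ι ℝ).toBasis)
    (by rw [LinearMap.det_toMatrix]; exact hB.isUnit)).toContinuousLinearEquiv
  have he : ∀ u, e u = B u := fun u => rfl
  have h := Measure.map_linearMap_addHaar_eq_smul_addHaar
    (volume : Measure (EuclideanSpace ℝ ι)) hB
  have h2 : ∫ u, f u ∂(Measure.map B volume) = ∫ u, f (B u) :=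
    e.toHomeomorph.measurableEmbedding.integral_map f
  rw [← h2, h, integral_smul_measure, ENNReal.toReal_ofReal (abs_nonneg _), abs_inv, smul_eq_mul]

theorem integrable_exp_linear_sub_sq_norm {s : ℝ} (hs : 0 < s) (w : EuclideanSpace ℝ ι) :
    Integrable fun u : EuclideanSpace ℝ ι => Real.exp (inner ℝ w u - ‖u‖ ^ 2 / (2 * s)) := by
  have h := (GaussianFourier.integrable_cexp_neg_mul_sq_norm_add
    (b := ((1 / (2 * s) : ℝ) : ℂ)) (by simpa using hs) 1 w).norm
  refine h.congr (Filter.Eventually.of_forall fun u => ?_)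
  simp only [Complex.norm_exp]
  congr 1
  norm_cast
  simp
  ring

theorem integral_exp_linear_sub_sq_norm {s : ℝ} (hs : 0 < s) (w : EuclideanSpace ℝ ι) :
    ∫ u : EuclideanSpace ℝ ι, Real.exp (inner ℝ w u - ‖u‖ ^ 2 / (2 * s)) =
      Real.exp (s * ‖w‖ ^ 2 / 2) * √(2 * Real.pi * s) ^ Fintype.card ι := by
  have h1 : ∀ u : EuclideanSpace ℝ ι, Real.exp (inner ℝ w u - ‖u‖ ^ 2 / (2 * s)) =
      Real.exp (s * ‖w‖ ^ 2 / 2) * Real.exp (-(1 / (2 * s)) * ‖u - s • w‖ ^ 2) := fun u => by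
    rw [← Real.exp_add, norm_sub_sq_real, norm_smul, inner_smul_right, real_inner_comm,
      Real.norm_eq_abs, mul_pow, sq_abs]
    congr 1
    field_simp
    ring
  simp_rw [h1]
  rw [integral_const_mul, integral_sub_right_eq_self
    (fun u : EuclideanSpace ℝ ι => Real.exp (-(1 / (2 * s)) * ‖u‖ ^ 2)),
    GaussianFourier.integral_rexp_neg_mul_sq_norm (by positivity), Real.sqrt_eq_rpow,
    ← Real.rpow_natCast _ (Fintype.card ι), ← Real.rpow_mul (by positivity)]
  congr 2
  · field_simp
  · simp; ring

/-- The exponential moment of a linear functional dominated by the quadratic form. -/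
theorem integral_exp_linear_sub_quadratic_le [DecidableEq ι] {M : Matrix ι ι ℝ} (hM : M.PosDef) {s C : ℝ}
    (hs : 0 < s) (hC : 0 ≤ C) (l : EuclideanSpace ℝ ι →ₗ[ℝ] ℝ)
    (hl : ∀ u, l u ^ 2 ≤ C * (u.ofLp ⬝ᵥ (M.mulVec u.ofLp))) :
    Integrable (fun u : EuclideanSpace ℝ ι =>
        Real.exp (l u - (u.ofLp ⬝ᵥ (M.mulVec u.ofLp)) / (2 * s))) ∧
      ∫ u : EuclideanSpace ℝ ι, Real.exp (l u - (u.ofLp ⬝ᵥ (M.mulVec u.ofLp)) / (2 * s)) ≤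
        Real.exp (s * C / 2) * (√(2 * Real.pi * s) ^ Fintype.card ι / √M.det) := by
  obtain ⟨B, hdet, hB⟩ := exists_linearMap_norm_sq_eq hM
  have hpos : 0 < √M.det := Real.sqrt_pos.2 hM.det_pos
  have hB0 : LinearMap.det B ≠ 0 := abs_pos.1 (hdet ▸ hpos)
  let e := LinearEquiv.ofIsUnitDet (f := B) (v := (EuclideanSpace.basisFun ι ℝ).toBasis)
    (v' := (EuclideanSpace.basisFun ι ℝ).toBasis)
    (by rw [LinearMap.det_toMatrix]; exact hB0.isUnit)
  let w : EuclideanSpace ℝ ι := (InnerProductSpace.toDual ℝ _).symm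
    (LinearMap.toContinuousLinearMap (l ∘ₗ e.symm.toLinearMap))
  have hw : ∀ u, inner ℝ w (B u) = l u := fun u => by
    have : inner ℝ w (e u) = (LinearMap.toContinuousLinearMap (l ∘ₗ e.symm.toLinearMap)) (e u) := by
      simp only [w, InnerProductSpace.toDual_symm_apply]
    rw [show e u = B u from rfl] at this
    rw [this]
    exact congrArg l (e.symm_apply_apply u)
  have hwC : ‖w‖ ^ 2 ≤ C := by
    obtain ⟨b, hb⟩ := e.surjective w
    have hb' : B b = w := hb
    have h1 := hl b
    rw [← hB, ← hw, hb', real_inner_self_eq_norm_sq] at h1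
    nlinarith [sq_nonneg ‖w‖]
  have h1 : ∀ u, Real.exp (l u - (u.ofLp ⬝ᵥ (M.mulVec u.ofLp)) / (2 * s)) =
      (fun v => Real.exp (inner ℝ w v - ‖v‖ ^ 2 / (2 * s))) (B u) := fun u => by
    simp only [hw, hB]
  simp_rw [h1]
  refine ⟨integrable_comp_linearMap_of_det_ne_zero hB0 (integrable_exp_linear_sub_sq_norm hs w), ?_⟩
  rw [integral_comp_linearMap_of_det_ne_zero hB0 (fun v => Real.exp (inner ℝ w v - ‖v‖ ^ 2 / (2 * s))),
    integral_exp_linear_sub_sq_norm hs, hdet]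
  have : Real.exp (s * ‖w‖ ^ 2 / 2) ≤ Real.exp (s * C / 2) := by gcongr
  calc _ = Real.exp (s * ‖w‖ ^ 2 / 2) * (√(2 * Real.pi * s) ^ Fintype.card ι / √M.det) := by
        ring
    _ ≤ _ := by gcongr

theorem integral_exp_neg_quadratic [DecidableEq ι] {M : Matrix ι ι ℝ} (hM : M.PosDef) {s : ℝ} (hs : 0 < s) :
    ∫ u : EuclideanSpace ℝ ι, Real.exp (-((u.ofLp ⬝ᵥ (M.mulVec u.ofLp)) / (2 * s))) =
      √(2 * Real.pi * s) ^ Fintype.card ι / √M.det := by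
  obtain ⟨B, hdet, hB⟩ := exists_linearMap_norm_sq_eq hM
  have hpos : 0 < √M.det := Real.sqrt_pos.2 hM.det_pos
  have hB0 : LinearMap.det B ≠ 0 := abs_pos.1 (hdet ▸ hpos)
  have h := integral_comp_linearMap_of_det_ne_zero hB0
    (fun v => Real.exp (inner ℝ 0 v - ‖v‖ ^ 2 / (2 * s)))
  rw [integral_exp_linear_sub_sq_norm hs, hdet] at h
  simp only [hB, inner_zero_left, zero_sub, norm_zero] at h
  rw [h]
  simp
  ring

end Gaussian

/-- Haar measure factors along a linear functional `z` and the complementary projection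
`u ↦ u - z u • e`, where `z e = 1`. -/
theorem exists_measure_integral_mul_eq {E : Type*} [NormedAddCommGroup E] [InnerProductSpace ℝ E]
    [FiniteDimensional ℝ E] [MeasurableSpace E] [BorelSpace E] (z : E →L[ℝ] ℝ) (e : E)
    (he : z e = 1) :
    ∃ ν : Measure E,
      (∀ (f : ℝ → ℝ) (k : E → ℝ),
        ∫ u, f (z u) * k (u - z u • e) = (∫ x, f x) * ∫ v, k v ∂ν) ∧
      ∀ (f : ℝ → ℝ) (k : E → ℝ), Integrable f → Integrable k ν →
        Integrable fun u => f (z u) * k (u - z u • e) := by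
  let W := LinearMap.ker (z : E →ₗ[ℝ] ℝ)
  let L : (ℝ × W) ≃L[ℝ] E := LinearEquiv.toContinuousLinearEquiv
    { toFun := fun p => p.1 • e + (p.2 : E)
      map_add' := fun p q => by simp [add_smul]; abel
      map_smul' := fun c p => by simp [mul_smul]
      invFun := fun u => (z u, ⟨u - z u • e, by simp [W, he]⟩)
      left_inv := fun p => by
        have : z (p.2 : E) = 0 := p.2.2
        ext <;> simp [he, this]
      right_inv := fun u => by simp }
  have hz : ∀ p, z (L p) = p.1 := fun p => by
    have : z (p.2 : E) = 0 := p.2.2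
    change z (p.1 • e + (p.2 : E)) = p.1
    simp [he, this]
  have hP : ∀ p, L p - z (L p) • e = p.2 := fun p => by
    rw [hz]; change p.1 • e + (p.2 : E) - p.1 • e = p.2; abel
  let m : Measure E := Measure.map L (volume.prod volume)
  have : m.IsAddHaarMeasure := L.isAddHaarMeasure_map _
  have hLm : MeasurableEmbedding L := L.toHomeomorph.measurableEmbedding
  have hm : (volume : Measure E) = (Measure.addHaarScalarFactor volume m) • m :=
    Measure.isAddLeftInvariant_eq_smul _ _
  set c := Measure.addHaarScalarFactor (volume : Measure E) m with hc
  let ν : Measure E := c • Measure.map ((↑) : W → E) volume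
  have hWm : MeasurableEmbedding ((↑) : W → E) :=
    MeasurableEmbedding.subtype_coe (Submodule.closed_of_finiteDimensional W).measurableSet
  have hc0 : c ≠ 0 := (Measure.addHaarScalarFactor_pos_of_isAddHaarMeasure _ _).ne'
  refine ⟨ν, fun f k => ?_, fun f k hf hk => ?_⟩
  · rw [hm, integral_smul_nnreal_measure, hLm.integral_map]
    change c • ∫ p, f (z (L p)) * k (L p - z (L p) • e) ∂_ = _
    simp_rw [hP, hz]
    rw [integral_prod_mul f (fun w : W => k w), integral_smul_nnreal_measure, hWm.integral_map,
      mul_smul_comm]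
  · have hk' : Integrable (fun w : W => k w) := by
      have h1 : Integrable k (Measure.map ((↑) : W → E) volume) := by
        have := hk.smul_measure_nnreal (c := c⁻¹)
        rwa [smul_smul, inv_mul_cancel₀ hc0, one_smul] at this
      exact h1.comp_measurable hWm.measurable
    rw [hm]
    refine Integrable.smul_measure_nnreal ?_
    rw [hLm.integrable_map_iff]
    refine (hf.mul_prod hk').congr (Filter.Eventually.of_forall fun p => ?_)
    change _ = f (z (L p)) * k (L p - z (L p) • e)
    rw [hP, hz]

section Poincare

variable {N : ℕ}

theorem sin_pi_div_le_sin_mul {n : ℕ} (h1 : 1 ≤ n) (h2 : n < N) :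
    Real.sin (Real.pi / N) ≤ Real.sin (Real.pi * n / N) := by
  have hN : (0 : ℝ) < N := by exact_mod_cast (by omega : 0 < N)
  have hn1 : (1 : ℝ) ≤ n := by exact_mod_cast h1
  have hn2 : (n : ℝ) + 1 ≤ N := by exact_mod_cast h2
  have hpi := Real.pi_pos
  have ha : Real.pi / N ≤ Real.pi * n / N := by gcongr; nlinarith
  have hb : Real.pi * n / N ≤ Real.pi - Real.pi / N := by
    rw [div_le_iff₀ hN, sub_mul, div_mul_cancel₀ _ hN.ne']; nlinarith
  have h0 : 0 < Real.pi / N := by positivity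
  rcases le_total (Real.pi * n / N) (Real.pi / 2) with h | h
  · exact Real.sin_le_sin_of_le_of_le_pi_div_two (by linarith) h ha
  · rw [← Real.sin_pi_sub (Real.pi * n / N)]
    exact Real.sin_le_sin_of_le_of_le_pi_div_two (by linarith) (by linarith) (by linarith)

variable [NeZero N]

open ZMod in
/-- Parseval's identity for the discrete Fourier transform. -/
theorem sum_norm_sq_dft (f : ZMod N → ℂ) :
    ∑ k, ‖ZMod.dft f k‖ ^ 2 = N * ∑ j, ‖f j‖ ^ 2 := by
  have key : ∑ k, (starRingEnd ℂ) (ZMod.dft f k) * ZMod.dft f k =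
      N * ∑ j, (starRingEnd ℂ) (f j) * f j := by
    have h1 : ∀ k, (starRingEnd ℂ) (ZMod.dft f k) =
        ∑ j, stdAddChar (j * k) * (starRingEnd ℂ) (f j) := fun k => by
      rw [dft_apply, map_sum]
      refine Finset.sum_congr rfl fun j _ => ?_
      rw [smul_eq_mul, map_mul, AddChar.map_neg_eq_conj, Complex.conj_conj]
    simp_rw [h1, Finset.sum_mul]
    rw [Finset.sum_comm, Finset.mul_sum]
    refine Finset.sum_congr rfl fun j _ => ?_
    have h2 := congrFun (dft_dft f) (-j)
    rw [dft_apply, neg_neg] at h2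
    simp only [smul_eq_mul] at h2
    calc _ = (starRingEnd ℂ) (f j) * ∑ k, stdAddChar (-(k * -j)) * ZMod.dft f k := by
          rw [Finset.mul_sum]
          refine Finset.sum_congr rfl fun k _ => ?_
          rw [mul_neg, neg_neg, mul_comm k j]
          ring
      _ = _ := by rw [h2]; ring
  have h3 : ∀ w : ℂ, (starRingEnd ℂ) w * w = ((‖w‖ ^ 2 : ℝ) : ℂ) := fun w => by
    rw [Complex.conj_mul']; push_cast; rfl
  simp_rw [h3] at key
  exact_mod_cast key

open ZMod in
theorem dft_comp_add_one (f : ZMod N → ℂ) (k : ZMod N) :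
    ZMod.dft (fun i => f (i + 1)) k = stdAddChar k * ZMod.dft f k := by
  rw [dft_apply, dft_apply, Finset.mul_sum,
    ← Equiv.sum_comp (Equiv.addRight (1 : ZMod N)) (fun j => stdAddChar k * stdAddChar (-(j * k)) • f j)]
  refine Finset.sum_congr rfl fun j _ => ?_
  simp only [Equiv.coe_addRight, smul_eq_mul]
  rw [← mul_assoc, ← AddChar.map_add_eq_mul]
  congr 2
  ring

open ZMod in
theorem four_mul_sin_sq_le_norm_one_sub_stdAddChar (hN : 2 ≤ N) {k : ZMod N} (hk : k ≠ 0) :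
    4 * Real.sin (Real.pi / N) ^ 2 ≤ ‖1 - stdAddChar k‖ ^ 2 := by
  have hv : 1 ≤ k.val := Nat.one_le_iff_ne_zero.2 (by simpa using hk)
  have hN0 : (0 : ℝ) < N := by exact_mod_cast (by omega : 0 < N)
  have h1 := sin_pi_div_le_sin_mul hv (ZMod.val_lt k)
  have h0 : 0 ≤ Real.sin (Real.pi / N) := by
    apply Real.sin_nonneg_of_nonneg_of_le_pi (by positivity)
    exact div_le_self Real.pi_pos.le (by exact_mod_cast (by omega : 1 ≤ N))
  have h2 : stdAddChar k = Complex.exp (Complex.I * ((2 * Real.pi * k.val / N : ℝ) : ℂ)) := by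
    have := stdAddChar_coe (N := N) (k.val : ℤ)
    rw [Int.cast_natCast, ZMod.natCast_zmod_val] at this
    rw [this]
    congr 1
    push_cast
    ring
  rw [norm_sub_rev, h2, Complex.norm_exp_I_mul_ofReal_sub_one, Real.norm_eq_abs, sq_abs,
    show 2 * Real.pi * (k.val : ℝ) / N / 2 = Real.pi * k.val / N by ring]
  nlinarith

/-- The discrete Poincaré inequality on the circle `ℤ/Nℤ`, with its sharp constant. -/
theorem four_mul_sin_sq_mul_sum_sq_le (hN : 2 ≤ N) (v : ZMod N → ℝ) (hv : ∑ i, v i = 0) :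
    4 * Real.sin (Real.pi / N) ^ 2 * ∑ i, v i ^ 2 ≤ ∑ i, (v i - v (i + 1)) ^ 2 := by
  have hN0 : (0 : ℝ) < N := by exact_mod_cast (by omega : 0 < N)
  let f : ZMod N → ℂ := fun i => (v i : ℂ)
  have h1 := sum_norm_sq_dft f
  have h2 := sum_norm_sq_dft (fun i => f i - f (i + 1))
  have h3 : ∀ k, ZMod.dft (fun i => f i - f (i + 1)) k =
      (1 - ZMod.stdAddChar k) * ZMod.dft f k := fun k => by
    have : (fun i => f i - f (i + 1)) = f - fun i => f (i + 1) := rfl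
    rw [this, map_sub, Pi.sub_apply, dft_comp_add_one]; ring
  have h4 : ∀ j, ‖f j‖ ^ 2 = v j ^ 2 := fun j => by simp [f]
  have h5 : ∀ j, ‖f j - f (j + 1)‖ ^ 2 = (v j - v (j + 1)) ^ 2 := fun j => by
    simp only [f]; rw [← Complex.ofReal_sub, Complex.norm_real, Real.norm_eq_abs, sq_abs]
  simp only [h3, h4, h5] at h1 h2
  have h6 : 4 * Real.sin (Real.pi / N) ^ 2 * ∑ k, ‖ZMod.dft f k‖ ^ 2 ≤
      ∑ k, ‖(1 - ZMod.stdAddChar k) * ZMod.dft f k‖ ^ 2 := by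
    rw [Finset.mul_sum]
    refine Finset.sum_le_sum fun k _ => ?_
    rcases eq_or_ne k 0 with rfl | hk
    · have : ZMod.dft f 0 = 0 := by
        rw [ZMod.dft_apply_zero]
        simp only [f]
        rw [← Complex.ofReal_sum, hv, Complex.ofReal_zero]
      simp [this]
    · rw [norm_mul, mul_pow]
      gcongr
      exact four_mul_sin_sq_le_norm_one_sub_stdAddChar hN hk
  rw [h1, h2] at h6
  nlinarith

theorem sum_range_natCast_add (f : ZMod N → ℝ) (i : ZMod N) :
    ∑ m ∈ Finset.range N, f (i + m) = ∑ k, f k := by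
  rw [← Equiv.sum_comp (Equiv.addLeft i) f]
  refine Finset.sum_nbij' (fun m => (m : ZMod N)) (fun k => k.val) ?_ ?_ ?_ ?_ ?_
  · simp
  · intro k _; simpa using ZMod.val_lt k
  · intro m hm; exact ZMod.val_cast_of_lt (by simpa using hm)
  · intro k _; simp
  · intro m _; simp

/-- The discrete Sobolev inequality on the circle `ℤ/Nℤ`. -/
theorem sq_le_mul_sum_sq_sub (v : ZMod N → ℝ) (hv : ∑ i, v i = 0) (i : ZMod N) :
    v i ^ 2 ≤ N * ∑ k, (v k - v (k + 1)) ^ 2 := by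
  have hN0 : (0 : ℝ) < N := by exact_mod_cast NeZero.pos N
  set S := ∑ k, |v k - v (k + 1)| with hS
  have h1 : ∀ n : ℕ, |v i - v (i + n)| ≤ ∑ m ∈ Finset.range n, |v (i + m) - v (i + m + 1)| := by
    intro n
    induction n with
    | zero => simp
    | succ n ih =>
      rw [Finset.sum_range_succ]
      refine le_trans ?_ (add_le_add_left ih _)
      push_cast
      rw [← add_assoc]
      exact abs_sub_le _ _ _
  have h2 : ∀ j, |v i - v j| ≤ S := fun j => by
    have h := h1 (j - i).val
    rw [ZMod.natCast_zmod_val, add_sub_cancel] at h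
    refine h.trans ?_
    rw [hS, ← sum_range_natCast_add (fun k => |v k - v (k + 1)|) i]
    refine Finset.sum_le_sum_of_subset_of_nonneg ?_ fun _ _ _ => abs_nonneg _
    exact Finset.range_subset_range.2 (ZMod.val_lt _).le
  have h3 : |v i| ≤ S := by
    have h4 : (N : ℝ) * v i = ∑ j, (v i - v j) := by
      rw [Finset.sum_sub_distrib, hv]; simp
    have h5 : (N : ℝ) * |v i| ≤ N * S := by
      rw [← abs_of_pos hN0, ← abs_mul, abs_of_pos hN0, h4]
      refine (Finset.abs_sum_le_sum_abs _ _).trans ((Finset.sum_le_sum fun j _ => h2 j).trans ?_)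
      simp
    exact le_of_mul_le_mul_left h5 hN0
  calc v i ^ 2 = |v i| ^ 2 := (sq_abs _).symm
    _ ≤ S ^ 2 := by gcongr
    _ ≤ (Finset.univ : Finset (ZMod N)).card * ∑ k, |v k - v (k + 1)| ^ 2 :=
        sq_sum_le_card_mul_sum_sq
    _ = N * ∑ k, (v k - v (k + 1)) ^ 2 := by simp [sq_abs, ZMod.card]

/-- The quadratic form of the Hessian of the potential at the origin. -/
def hessianForm (N : ℕ) [NeZero N] (γ : ℝ) (v : ZMod N → ℝ) : ℝ :=
  γ / 2 * ∑ i, (v i - v (i + 1)) ^ 2 - ∑ i, v i ^ 2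

theorem mul_sq_le_hessianForm (hN : 2 ≤ N) {μ : ℝ} (hμ : 1 < μ) (v : ZMod N → ℝ)
    (hv : ∑ i, v i = 0) (i : ZMod N) :
    N * ((μ - 1) / (4 * Real.pi ^ 2) * v i ^ 2) ≤ hessianForm N (μ * couplingThreshold N) v := by
  have hN0 : (0 : ℝ) < N := by exact_mod_cast (by omega : 0 < N)
  have hN2 : (2 : ℝ) ≤ N := by exact_mod_cast hN
  have hpi := Real.pi_pos
  have hs : 0 < Real.sin (Real.pi / N) := by
    apply Real.sin_pos_of_pos_of_lt_pi (by positivity)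
    rw [div_lt_iff₀ hN0]; nlinarith
  have hs2 : Real.sin (Real.pi / N) ^ 2 ≤ Real.pi ^ 2 / N ^ 2 := by
    rw [← div_pow]; gcongr; exact Real.sin_le (by positivity)
  have hP := four_mul_sin_sq_mul_sum_sq_le hN v hv
  have hS := sq_le_mul_sum_sq_sub v hv i
  set D := ∑ k, (v k - v (k + 1)) ^ 2
  have hD : 0 ≤ D := Finset.sum_nonneg fun _ _ => sq_nonneg _
  set s := Real.sin (Real.pi / N)
  have hP' : ∑ i, v i ^ 2 ≤ D / (4 * s ^ 2) := by
    rw [le_div_iff₀ (by positivity)]; linarith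
  have h1 : (μ - 1) * (D / (4 * s ^ 2)) ≤ hessianForm N (μ * couplingThreshold N) v := by
    have : μ * couplingThreshold N / 2 * D = μ * (D / (4 * s ^ 2)) := by
      rw [show couplingThreshold N = 1 / (2 * s ^ 2) from rfl]; field_simp; ring
    rw [hessianForm, this]; linarith
  refine le_trans ?_ h1
  have h2 : N ^ 2 * D / (4 * Real.pi ^ 2) ≤ D / (4 * s ^ 2) := by
    rw [div_le_div_iff₀ (by positivity) (by positivity)]
    rw [le_div_iff₀ (by positivity)] at hs2
    nlinarith
  calc N * ((μ - 1) / (4 * Real.pi ^ 2) * v i ^ 2)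
      ≤ N * ((μ - 1) / (4 * Real.pi ^ 2) * (N * D)) := by
        have : 0 ≤ μ - 1 := by linarith
        gcongr
    _ = (μ - 1) * (N ^ 2 * D / (4 * Real.pi ^ 2)) := by ring
    _ ≤ _ := mul_le_mul_of_nonneg_left h2 (by linarith)

end Poincare

section Hessian

variable {N : ℕ}

/-- The coordinate functionals. -/
def coord (i : ZMod N) : EuclideanSpace ℝ (ZMod N) →L[ℝ] ℝ := EuclideanSpace.proj i

@[simp]
theorem coord_apply (i : ZMod N) (u : EuclideanSpace ℝ (ZMod N)) : coord i u = u i := rfl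

variable [NeZero N]

theorem hasFDerivAt_potential (γ : ℝ) (u : EuclideanSpace ℝ (ZMod N)) :
    HasFDerivAt (potential N γ)
      (∑ i, (u i ^ 3 - u i) • coord i +
        (γ / 2) • ∑ i, (u i - u (i + 1)) •
          (coord i -
            coord (i + 1))) u := by
  have hp : ∀ i : ZMod N, HasFDerivAt (fun x : EuclideanSpace ℝ (ZMod N) => x i)
      (coord i) u := fun i =>
    (coord i).hasFDerivAt
  have h := (HasFDerivAt.fun_sum (u := Finset.univ) fun i _ =>
    (((hp i).pow 4).const_mul (1 / 4)).sub (((hp i).pow 2).const_mul (1 / 2))).add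
    ((HasFDerivAt.fun_sum (u := Finset.univ) fun i _ =>
      ((hp i).sub (hp (i + 1))).pow 2).const_mul (γ / 4))
  refine h.congr_fderiv ?_
  congr 1
  · refine Finset.sum_congr rfl fun i _ => ?_
    ext w; simp; ring
  · rw [Finset.smul_sum, Finset.smul_sum]
    refine Finset.sum_congr rfl fun i _ => ?_
    ext w; simp; ring

/-- The difference operator `u ↦ (u k - u (k + 1))_k` as a matrix. -/
def differenceMatrix (N : ℕ) [NeZero N] : Matrix (ZMod N) (ZMod N) ℝ :=
  Matrix.of fun k i => (if k = i then 1 else 0) - (if k + 1 = i then 1 else 0)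

theorem differenceMatrix_mulVec (u : ZMod N → ℝ) (k : ZMod N) :
    (differenceMatrix N).mulVec u k = u k - u (k + 1) := by
  simp [differenceMatrix, Matrix.mulVec, dotProduct, sub_mul, Finset.sum_sub_distrib]

theorem hessianMatrix_potential_zero (γ : ℝ) :
    hessianMatrix (potential N γ) 0 =
      (γ / 2) • ((differenceMatrix N).transpose * differenceMatrix N) - 1 := by
  ext i j
  rw [hessianMatrix, Matrix.of_apply, iteratedFDeriv_two_apply]
  have h1 : fderiv ℝ (potential N γ) = _ := funext fun u => (hasFDerivAt_potential γ u).fderiv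
  have hp : ∀ i : ZMod N, HasFDerivAt (fun x : EuclideanSpace ℝ (ZMod N) => x i)
      (coord i) 0 := fun i =>
    (coord i).hasFDerivAt
  have h2 := (HasFDerivAt.fun_sum (u := Finset.univ) fun i _ =>
    (((hp i).pow 3).sub (hp i)).smul_const
      (coord i)).add
    ((HasFDerivAt.fun_sum (u := Finset.univ) fun i _ =>
      ((hp i).sub (hp (i + 1))).smul_const
      (coord i -
            coord (i + 1))).const_smul (γ / 2))
  have h3 := h2.fderiv
  rw [h1]
  erw [h3]
  simp only [add_apply, sum_apply, Matrix.cons_val_zero,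
    Matrix.cons_val_one, smul_apply, ContinuousLinearMap.smulRight_apply,
    sub_apply, coord_apply, Matrix.sub_apply, Matrix.smul_apply,
    Matrix.mul_apply, Matrix.transpose_apply, differenceMatrix, Matrix.of_apply, Matrix.one_apply]
  simp [mul_comm]
  rw [neg_add_eq_sub]
  simp only [eq_comm (a := j) (b := i)]

/-- The Hessian at the origin with its negative eigenvalue flipped. -/
def flippedHessian (N : ℕ) [NeZero N] (γ : ℝ) : Matrix (ZMod N) (ZMod N) ℝ :=
  hessianMatrix (potential N γ) 0 + (2 / N : ℝ) • Matrix.of fun _ _ => 1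

theorem hessianMatrix_mulVec_one (γ : ℝ) :
    (hessianMatrix (potential N γ) 0).mulVec (fun _ => 1) = fun _ => -1 := by
  have h : (differenceMatrix N).mulVec (fun _ => 1) = 0 := by
    ext k; simp [differenceMatrix_mulVec]
  rw [hessianMatrix_potential_zero, Matrix.sub_mulVec, Matrix.smul_mulVec, ← Matrix.mulVec_mulVec, h]
  ext; simp

theorem det_flippedHessian (γ : ℝ) :
    (flippedHessian N γ).det = -(hessianMatrix (potential N γ) 0).det := by
  have hN : (N : ℝ) ≠ 0 := by exact_mod_cast NeZero.ne N
  set H := hessianMatrix (potential N γ) 0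
  have h1 : flippedHessian N γ = H * (1 + Matrix.replicateCol Unit (fun _ : ZMod N => (-2 / N : ℝ)) *
      Matrix.replicateRow Unit fun _ : ZMod N => (1 : ℝ)) := by
    rw [mul_add, mul_one, flippedHessian]
    congr 1
    ext i j
    have := congrFun (hessianMatrix_mulVec_one (N := N) γ) i
    simp only [Matrix.mulVec, dotProduct, mul_one] at this
    rw [Matrix.mul_apply]
    simp only [Matrix.mul_apply, Matrix.replicateCol_apply, Matrix.replicateRow_apply]
    simp only [Finset.univ_unique, Finset.sum_const, mul_one, Finset.card_singleton, one_smul]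
    rw [← Finset.sum_mul, this]
    simp; ring
  rw [h1, Matrix.det_mul, Matrix.det_one_add_replicateCol_mul_replicateRow]
  simp [dotProduct]
  field_simp
  ring

theorem dotProduct_flippedHessian_mulVec (γ : ℝ) (u : ZMod N → ℝ) :
    u ⬝ᵥ (flippedHessian N γ).mulVec u = hessianForm N γ u + 2 / N * (∑ i, u i) ^ 2 := by
  rw [flippedHessian, Matrix.add_mulVec, dotProduct_add, hessianMatrix_potential_zero,
    Matrix.sub_mulVec, Matrix.smul_mulVec, dotProduct_sub, dotProduct_smul,
    ← Matrix.mulVec_mulVec, Matrix.dotProduct_mulVec, Matrix.vecMul_transpose, Matrix.one_mulVec,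
    hessianForm]
  congr 1
  · simp only [dotProduct, differenceMatrix_mulVec, smul_eq_mul, pow_two]
  · rw [Matrix.smul_mulVec, dotProduct_smul, smul_eq_mul]
    simp [Matrix.mulVec, dotProduct, ← Finset.sum_mul, pow_two]

theorem hessianForm_add_const (γ a : ℝ) (v : ZMod N → ℝ) (hv : ∑ i, v i = 0) :
    hessianForm N γ (fun i => a + v i) = hessianForm N γ v - N * a ^ 2 := by
  simp only [hessianForm, add_sub_add_left_eq_sub, add_sq, Finset.sum_add_distrib]
  rw [← Finset.mul_sum, hv]
  simp
  ring

theorem posDef_flippedHessian (hN : 2 ≤ N) {μ : ℝ} (hμ : 1 < μ) :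
    (flippedHessian N (μ * couplingThreshold N)).PosDef := by
  have hN0 : (0 : ℝ) < N := by exact_mod_cast NeZero.pos N
  set γ := μ * couplingThreshold N
  refine Matrix.PosDef.of_dotProduct_mulVec_pos ?_ fun u hu => ?_
  · rw [Matrix.IsHermitian, Matrix.conjTranspose_eq_transpose_of_trivial, flippedHessian,
      hessianMatrix_potential_zero]
    simp [Matrix.transpose_mul]
    rfl
  · rw [star_trivial, dotProduct_flippedHessian_mulVec]
    set a := (∑ i, u i) / N
    set v : ZMod N → ℝ := fun i => u i - a
    have hv : ∑ i, v i = 0 := by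
      simp [v, Finset.sum_sub_distrib, a]; field_simp; ring
    have hu' : u = fun i => a + v i := by ext i; simp [v]
    have hsum : ∑ i, u i = N * a := by simp only [a]; field_simp
    have hq : hessianForm N γ u = hessianForm N γ v - N * a ^ 2 := by
      conv_lhs => rw [hu']
      exact hessianForm_add_const γ a v hv
    rw [hsum, hq, show hessianForm N γ v - N * a ^ 2 + 2 / N * (N * a) ^ 2 =
      hessianForm N γ v + N * a ^ 2 by field_simp; ring]
    have hc : 0 < (μ - 1) / (4 * Real.pi ^ 2) := by
      have := Real.pi_pos; have : 0 < μ - 1 := by linarith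
      positivity
    by_contra hcon
    push Not at hcon
    have h0 : ∀ i, 0 ≤ hessianForm N γ v := fun i =>
      le_trans (by positivity) (mul_sq_le_hessianForm hN hμ v hv i)
    have ha : a = 0 := by
      have := h0 0
      have h2 : N * a ^ 2 ≤ 0 := by linarith
      have : a ^ 2 ≤ 0 := by nlinarith
      nlinarith
    have hv0 : ∀ i, v i = 0 := fun i => by
      have h1 := mul_sq_le_hessianForm hN hμ v hv i
      have h2 : N * ((μ - 1) / (4 * Real.pi ^ 2) * v i ^ 2) ≤ 0 := by
        have : 0 ≤ N * a ^ 2 := by positivity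
        linarith
      by_contra hne
      have : 0 < N * ((μ - 1) / (4 * Real.pi ^ 2) * v i ^ 2) := by positivity
      linarith
    apply hu
    rw [hu']; ext i; simp [ha, hv0]

end Hessian

section Decomposition

variable {N : ℕ} [NeZero N]

/-- The mean `(1/N) ∑ u i`. -/
def mean (N : ℕ) [NeZero N] : EuclideanSpace ℝ (ZMod N) →L[ℝ] ℝ := (N : ℝ)⁻¹ • ∑ i, coord i

theorem mean_apply (u : EuclideanSpace ℝ (ZMod N)) : mean N u = (N : ℝ)⁻¹ * ∑ i, u i := by
  simp [mean, sum_apply]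

theorem natCast_pos_of_neZero (N : ℕ) [NeZero N] : (0 : ℝ) < N := by
  exact_mod_cast NeZero.pos N

theorem mean_constConfig (a : ℝ) : mean N (constConfig N a) = a := by
  have := (natCast_pos_of_neZero N).ne'
  simp [mean_apply, constConfig]
  field_simp

/-- The fluctuation of a configuration about its mean. -/
def fluct (u : EuclideanSpace ℝ (ZMod N)) : EuclideanSpace ℝ (ZMod N) :=
  u - mean N u • constConfig N 1

theorem fluct_apply (u : EuclideanSpace ℝ (ZMod N)) (i : ZMod N) : fluct u i = u i - mean N u := by
  simp [fluct, constConfig]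

theorem sum_fluct (u : EuclideanSpace ℝ (ZMod N)) : ∑ i, fluct u i = 0 := by
  have := (natCast_pos_of_neZero N).ne'
  simp [fluct_apply, Finset.sum_sub_distrib, mean_apply]
  field_simp
  simp

theorem contDiff_fluct : ContDiff ℝ ((⊤ : ℕ∞) : WithTop ℕ∞) (fluct (N := N)) := by
  unfold fluct; fun_prop

/-- The potential on constant configurations. -/
def doubleWell (z : ℝ) : ℝ := z ^ 4 / 4 - z ^ 2 / 2

/-- The empirical second moment. -/
def secondMoment (v : EuclideanSpace ℝ (ZMod N)) : ℝ := (N : ℝ)⁻¹ * ∑ i, v i ^ 2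

/-- The empirical fourth moment. -/
def fourthMoment (v : EuclideanSpace ℝ (ZMod N)) : ℝ := (N : ℝ)⁻¹ * ∑ i, v i ^ 4

theorem secondMoment_nonneg (v : EuclideanSpace ℝ (ZMod N)) : 0 ≤ secondMoment v :=
  mul_nonneg (by positivity) (Finset.sum_nonneg fun _ _ => by positivity)

theorem fourthMoment_nonneg (v : EuclideanSpace ℝ (ZMod N)) : 0 ≤ fourthMoment v :=
  mul_nonneg (by positivity) (Finset.sum_nonneg fun _ _ => by positivity)

theorem sq_secondMoment_le (v : EuclideanSpace ℝ (ZMod N)) :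
    secondMoment v ^ 2 ≤ fourthMoment v := by
  have hN := natCast_pos_of_neZero N
  have h := sq_sum_le_card_mul_sum_sq (s := Finset.univ) (f := fun i => v i ^ 2)
  simp only [Finset.card_univ, ZMod.card, ← pow_mul] at h
  rw [secondMoment, fourthMoment, mul_pow]
  calc (N : ℝ)⁻¹ ^ 2 * (∑ i, v i ^ 2) ^ 2 ≤ (N : ℝ)⁻¹ ^ 2 * (N * ∑ i, v i ^ 4) := by gcongr
    _ = _ := by field_simp

theorem rescaledPotential_eq (γ : ℝ) (u : EuclideanSpace ℝ (ZMod N)) :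
    rescaledPotential N γ u = doubleWell (mean N u) + hessianForm N γ (fluct u) / (2 * N) +
      (N : ℝ)⁻¹ * ∑ i, (3 / 2 * mean N u ^ 2 * fluct u i ^ 2 + mean N u * fluct u i ^ 3 +
        fluct u i ^ 4 / 4) := by
  have hN := (natCast_pos_of_neZero N).ne'
  set z := mean N u
  set v := fluct u
  have hu : ∀ i, u i = z + v i := fun i => by simp [v, fluct_apply, z]
  have hv : ∑ i, v i = 0 := sum_fluct u
  have h1 : ∑ i : ZMod N, ((1 / 4) * u i ^ 4 - (1 / 2) * u i ^ 2) =
      N * doubleWell z - (∑ i, v i ^ 2) / 2 +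
      ∑ i, (3 / 2 * z ^ 2 * v i ^ 2 + z * v i ^ 3 + v i ^ 4 / 4) := by
    have : ∀ i, (1 / 4) * u i ^ 4 - (1 / 2) * u i ^ 2 = doubleWell z + (z ^ 3 - z) * v i
        - 1 / 2 * v i ^ 2 + (3 / 2 * z ^ 2 * v i ^ 2 + z * v i ^ 3 + v i ^ 4 / 4) := fun i => by
      rw [hu, doubleWell]; ring
    simp_rw [this]
    rw [Finset.sum_add_distrib, Finset.sum_sub_distrib, Finset.sum_add_distrib, ← Finset.mul_sum,
      ← Finset.mul_sum, hv]
    simp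
    ring
  have h2 : ∑ i, (u i - u (i + 1)) ^ 2 = ∑ i, (v i - v (i + 1)) ^ 2 :=
    Finset.sum_congr rfl fun i _ => by rw [hu, hu]; ring
  rw [rescaledPotential, potential, h1, h2, hessianForm]
  generalize ∑ i, (3 / 2 * z ^ 2 * v i ^ 2 + z * v i ^ 3 + v i ^ 4 / 4) = q
  field_simp
  ring

theorem le_rescaledPotential (γ : ℝ) (u : EuclideanSpace ℝ (ZMod N)) :
    doubleWell (mean N u) + hessianForm N γ (fluct u) / (2 * N) ≤ rescaledPotential N γ u := by
  rw [rescaledPotential_eq]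
  refine le_add_of_nonneg_right (mul_nonneg (by positivity) (Finset.sum_nonneg fun i _ => ?_))
  nlinarith [sq_nonneg (fluct u i * (fluct u i + 2 * mean N u)),
    sq_nonneg (fluct u i * mean N u)]

theorem rescaledPotential_le (γ : ℝ) (u : EuclideanSpace ℝ (ZMod N)) :
    rescaledPotential N γ u ≤ doubleWell (mean N u) + hessianForm N γ (fluct u) / (2 * N) +
      (2 * mean N u ^ 2 * secondMoment (fluct u) + 3 / 4 * fourthMoment (fluct u)) := by
  rw [rescaledPotential_eq]
  gcongr
  rw [secondMoment, fourthMoment, show ∀ a b c d e : ℝ, 2 * a * (b * c) + d * (b * e) =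
    b * (2 * a * c + d * e) by intros; ring, Finset.mul_sum (f := fun i => fluct u i ^ 2),
    Finset.mul_sum (f := fun i => fluct u i ^ 4), ← Finset.sum_add_distrib]
  refine mul_le_mul_of_nonneg_left (Finset.sum_le_sum fun i _ => ?_) (by positivity)
  nlinarith [sq_nonneg (fluct u i * (mean N u - fluct u i))]

theorem norm_sub_constConfig_sq (u : EuclideanSpace ℝ (ZMod N)) (a : ℝ) :
    ‖u - constConfig N a‖ ^ 2 = N * ((mean N u - a) ^ 2 + secondMoment (fluct u)) := by
  have hN := (natCast_pos_of_neZero N).ne'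
  rw [EuclideanSpace.real_norm_sq_eq]
  have h : ∀ i, (u - constConfig N a) i ^ 2 = (mean N u - a) ^ 2 +
      2 * (mean N u - a) * fluct u i + fluct u i ^ 2 := fun i => by
    rw [fluct_apply]; simp [constConfig]; ring
  simp_rw [h]
  rw [Finset.sum_add_distrib, Finset.sum_add_distrib, ← Finset.mul_sum, sum_fluct, secondMoment]
  simp
  field_simp

theorem norm_sq_eq (u : EuclideanSpace ℝ (ZMod N)) :
    ‖u‖ ^ 2 = N * (mean N u ^ 2 + secondMoment (fluct u)) := by
  have := norm_sub_constConfig_sq u 0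
  rwa [show constConfig N 0 = 0 from rfl, sub_zero, sub_zero] at this

theorem mem_ball_constConfig_iff {ρ : ℝ} (hρ : 0 < ρ) (u : EuclideanSpace ℝ (ZMod N)) (a : ℝ) :
    u ∈ Metric.ball (constConfig N a) (ρ * √(N : ℝ)) ↔
      (mean N u - a) ^ 2 + secondMoment (fluct u) < ρ ^ 2 := by
  have hN := natCast_pos_of_neZero N
  rw [mem_ball_iff_norm, ← sq_lt_sq₀ (norm_nonneg _) (by positivity), norm_sub_constConfig_sq,
    mul_pow, Real.sq_sqrt hN.le, mul_comm (ρ ^ 2), mul_lt_mul_iff_right₀ hN]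

theorem dotProduct_flippedHessian_eq (γ : ℝ) (u : EuclideanSpace ℝ (ZMod N)) :
    u.ofLp ⬝ᵥ (flippedHessian N γ).mulVec u.ofLp =
      N * mean N u ^ 2 + hessianForm N γ (fluct u) := by
  have hN := (natCast_pos_of_neZero N).ne'
  rw [dotProduct_flippedHessian_mulVec]
  have hu : u.ofLp = fun i => mean N u + fluct u i := by ext i; simp [fluct_apply]
  have h := hessianForm_add_const γ (mean N u) (fluct u).ofLp (sum_fluct u)
  rw [← hu] at h
  rw [h, mean_apply]
  field_simp
  ring

/-- The Gaussian weight of the fluctuations. -/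
def fluctWeight (N : ℕ) [NeZero N] (γ ε : ℝ) (v : EuclideanSpace ℝ (ZMod N)) : ℝ :=
  Real.exp (-(hessianForm N γ v / (2 * N * ε)))

theorem exp_mul_fluctWeight (γ : ℝ) {ε : ℝ} (hε : 0 < ε) (u : EuclideanSpace ℝ (ZMod N)) :
    Real.exp (-(1 / (2 * ε)) * mean N u ^ 2) * fluctWeight N γ ε (fluct u) =
      Real.exp (-((u.ofLp ⬝ᵥ (flippedHessian N γ).mulVec u.ofLp) / (2 * (N * ε)))) := by
  have hN := natCast_pos_of_neZero N
  rw [fluctWeight, ← Real.exp_add, dotProduct_flippedHessian_eq]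
  congr 1
  field_simp
  ring

/-- The total mass of the Gaussian approximation of the Gibbs measure. -/
def gaussMass (N : ℕ) [NeZero N] (γ ε : ℝ) : ℝ :=
  √(2 * Real.pi * (N * ε)) ^ N / √(flippedHessian N γ).det

theorem integral_exp_mul_fluctWeight (hN : 2 ≤ N) {μ ε : ℝ} (hμ : 1 < μ) (hε : 0 < ε) :
    ∫ u, Real.exp (-(1 / (2 * ε)) * mean N u ^ 2) *
      fluctWeight N (μ * couplingThreshold N) ε (fluct u) =
      gaussMass N (μ * couplingThreshold N) ε := by
  have hN0 := natCast_pos_of_neZero N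
  simp_rw [exp_mul_fluctWeight _ hε]
  rw [integral_exp_neg_quadratic (posDef_flippedHessian hN hμ) (by positivity), ZMod.card]
  rfl

theorem gaussMass_pos (hN : 2 ≤ N) {μ ε : ℝ} (hμ : 1 < μ) (hε : 0 < ε) :
    0 < gaussMass N (μ * couplingThreshold N) ε := by
  have hN0 := natCast_pos_of_neZero N
  have := Real.sqrt_pos.2 (posDef_flippedHessian hN hμ).det_pos
  unfold gaussMass
  have := Real.pi_pos
  positivity

theorem pow_four_le_exp (x : ℝ) : x ^ 4 ≤ 24 * (Real.exp x + Real.exp (-x)) := by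
  have h1 : |x| ^ 4 / 24 ≤ Real.exp |x| := by
    simpa [Nat.factorial] using Real.pow_div_factorial_le_exp |x| (abs_nonneg x) 4
  have h2 : Real.exp |x| ≤ Real.exp x + Real.exp (-x) := by
    rcases abs_cases x with ⟨h, _⟩ | ⟨h, _⟩ <;> rw [h]
    · linarith [Real.exp_pos (-x)]
    · linarith [Real.exp_pos x]
  have h3 : |x| ^ 4 = x ^ 4 := (even_two_mul 2).pow_abs x
  linarith

theorem integral_fluct_pow_four_le (hN : 2 ≤ N) {μ ε : ℝ} (hμ : 1 < μ) (hε : 0 < ε) (i : ZMod N) :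
    Integrable (fun u => (Real.exp (-(1 / (2 * ε)) * mean N u ^ 2) *
        fluctWeight N (μ * couplingThreshold N) ε (fluct u)) * fluct u i ^ 4) ∧
      ∫ u, (Real.exp (-(1 / (2 * ε)) * mean N u ^ 2) *
        fluctWeight N (μ * couplingThreshold N) ε (fluct u)) * fluct u i ^ 4 ≤
      48 * Real.exp (2 * Real.pi ^ 2 / (μ - 1)) * ε ^ 2 *
        gaussMass N (μ * couplingThreshold N) ε := by
  have hN0 := natCast_pos_of_neZero N
  have hμ' : 0 < μ - 1 := by linarith
  have hpi := Real.pi_pos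
  set γ := μ * couplingThreshold N
  let l : EuclideanSpace ℝ (ZMod N) →ₗ[ℝ] ℝ :=
    (√ε)⁻¹ • ((coord i - mean N : EuclideanSpace ℝ (ZMod N) →L[ℝ] ℝ) : _ →ₗ[ℝ] ℝ)
  have hl : ∀ u, l u = (√ε)⁻¹ * fluct u i := fun u => by simp [l, fluct_apply]
  set C : ℝ := 4 * Real.pi ^ 2 / (μ - 1) / (N * ε) with hC
  have hC0 : 0 ≤ C := by positivity
  have hlC : ∀ u, l u ^ 2 ≤ C * (u.ofLp ⬝ᵥ ((flippedHessian N γ).mulVec u.ofLp)) := fun u => by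
    rw [hl, mul_pow, inv_pow, Real.sq_sqrt hε.le, dotProduct_flippedHessian_eq]
    have h := mul_sq_le_hessianForm hN hμ _ (sum_fluct u) i
    have h2 : fluct u i ^ 2 * N = 4 * Real.pi ^ 2 / (μ - 1) *
        (N * ((μ - 1) / (4 * Real.pi ^ 2) * fluct u i ^ 2)) := by field_simp
    calc ε⁻¹ * fluct u i ^ 2 = (fluct u i ^ 2 * N) / (N * ε) := by field_simp
      _ ≤ 4 * Real.pi ^ 2 / (μ - 1) * (N * mean N u ^ 2 + hessianForm N γ (fluct u)) / (N * ε) := by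
        rw [h2]; gcongr
        refine h.trans (le_add_of_nonneg_left (by positivity))
      _ = _ := by rw [hC]; ring
  have hlC' : ∀ u, (-l) u ^ 2 ≤ C * (u.ofLp ⬝ᵥ ((flippedHessian N γ).mulVec u.ofLp)) := fun u => by
    simpa using hlC u
  have hs : 0 < N * ε := by positivity
  obtain ⟨i1, b1⟩ := integral_exp_linear_sub_quadratic_le (posDef_flippedHessian hN hμ) hs hC0 l hlC
  obtain ⟨i2, b2⟩ :=
    integral_exp_linear_sub_quadratic_le (posDef_flippedHessian hN hμ) hs hC0 (-l) hlC'
  rw [ZMod.card] at b1 b2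
  have hpt : ∀ u, (Real.exp (-(1 / (2 * ε)) * mean N u ^ 2) *
      fluctWeight N γ ε (fluct u)) * fluct u i ^ 4 ≤ 24 * ε ^ 2 *
      (Real.exp (l u - (u.ofLp ⬝ᵥ ((flippedHessian N γ).mulVec u.ofLp)) / (2 * (N * ε))) +
      Real.exp ((-l) u - (u.ofLp ⬝ᵥ ((flippedHessian N γ).mulVec u.ofLp)) / (2 * (N * ε)))) :=
      fun u => by
    rw [exp_mul_fluctWeight _ hε, sub_eq_add_neg, sub_eq_add_neg, Real.exp_add, Real.exp_add,
      ← add_mul]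
    have h := pow_four_le_exp (l u)
    have h4 : fluct u i ^ 4 = ε ^ 2 * l u ^ 4 := by
      rw [hl, mul_pow, inv_pow, show √ε ^ 4 = (√ε ^ 2) ^ 2 by ring, Real.sq_sqrt hε.le]
      field_simp
    rw [h4, LinearMap.neg_apply]
    have h5 := Real.exp_pos (-((u.ofLp ⬝ᵥ ((flippedHessian N γ).mulVec u.ofLp)) / (2 * (N * ε))))
    calc _ ≤ Real.exp (-((u.ofLp ⬝ᵥ ((flippedHessian N γ).mulVec u.ofLp)) / (2 * (N * ε)))) *
          (ε ^ 2 * (24 * (Real.exp (l u) + Real.exp (-l u)))) := by gcongr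
      _ = _ := by ring
  have hint := (i1.add i2).const_mul (24 * ε ^ 2)
  have hI : Integrable (fun u => (Real.exp (-(1 / (2 * ε)) * mean N u ^ 2) *
        fluctWeight N γ ε (fluct u)) * fluct u i ^ 4) := by
    refine hint.mono' ?_ (Filter.Eventually.of_forall fun u => ?_)
    · refine Continuous.aestronglyMeasurable ?_
      unfold fluctWeight hessianForm fluct
      fun_prop
    · rw [Real.norm_of_nonneg]
      · exact hpt u
      · unfold fluctWeight; positivity
  refine ⟨hI, (integral_mono hI hint hpt).trans ?_⟩
  rw [integral_const_mul, integral_add' i1 i2]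
  have h6 : N * ε * C / 2 = 2 * Real.pi ^ 2 / (μ - 1) := by rw [hC]; field_simp; ring
  rw [h6] at b1 b2
  unfold gaussMass
  calc _ ≤ 24 * ε ^ 2 * (Real.exp (2 * Real.pi ^ 2 / (μ - 1)) *
        (√(2 * Real.pi * (N * ε)) ^ N / √(flippedHessian N γ).det) +
        Real.exp (2 * Real.pi ^ 2 / (μ - 1)) *
        (√(2 * Real.pi * (N * ε)) ^ N / √(flippedHessian N γ).det)) := by gcongr
    _ = _ := by ring

theorem integral_fourthMoment_le (hN : 2 ≤ N) {μ ε : ℝ} (hμ : 1 < μ) (hε : 0 < ε) :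
    Integrable (fun u => (Real.exp (-(1 / (2 * ε)) * mean N u ^ 2) *
        fluctWeight N (μ * couplingThreshold N) ε (fluct u)) * fourthMoment (fluct u)) ∧
      ∫ u, (Real.exp (-(1 / (2 * ε)) * mean N u ^ 2) *
        fluctWeight N (μ * couplingThreshold N) ε (fluct u)) * fourthMoment (fluct u) ≤
      48 * Real.exp (2 * Real.pi ^ 2 / (μ - 1)) * ε ^ 2 *
        gaussMass N (μ * couplingThreshold N) ε := by
  have hN0 := natCast_pos_of_neZero N
  have h : ∀ u, (Real.exp (-(1 / (2 * ε)) * mean N u ^ 2) *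
      fluctWeight N (μ * couplingThreshold N) ε (fluct u)) * fourthMoment (fluct u) =
      (N : ℝ)⁻¹ * ∑ i, (Real.exp (-(1 / (2 * ε)) * mean N u ^ 2) *
      fluctWeight N (μ * couplingThreshold N) ε (fluct u)) * fluct u i ^ 4 := fun u => by
    rw [fourthMoment, ← Finset.mul_sum]; ring
  simp_rw [h]
  have hi := fun i => (integral_fluct_pow_four_le hN hμ hε i).1
  refine ⟨(integrable_finsetSum _ fun i _ => hi i).const_mul _, ?_⟩
  rw [integral_const_mul, integral_finsetSum _ fun i _ => hi i]
  calc _ ≤ (N : ℝ)⁻¹ * ∑ i : ZMod N, 48 * Real.exp (2 * Real.pi ^ 2 / (μ - 1)) * ε ^ 2 *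
        gaussMass N (μ * couplingThreshold N) ε := by
        gcongr with i
        exact (integral_fluct_pow_four_le hN hμ hε i).2
    _ = _ := by simp; field_simp

end Decomposition

section OneDimensional

theorem integral_exp_neg_sq_div {ε : ℝ} (hε : 0 < ε) :
    ∫ x : ℝ, Real.exp (-(1 / (2 * ε)) * x ^ 2) = √(2 * Real.pi * ε) := by
  rw [integral_gaussian]; congr 1; field_simp

theorem integrable_exp_neg_sq_div {ε : ℝ} (hε : 0 < ε) :
    Integrable fun x : ℝ => Real.exp (-(1 / (2 * ε)) * x ^ 2) :=
  integrable_exp_neg_mul_sq (by positivity)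

theorem neg_sq_div_two_le_doubleWell (x : ℝ) : -(x ^ 2 / 2) ≤ doubleWell x := by
  unfold doubleWell; nlinarith [sq_nonneg (x ^ 2)]

theorem sq_div_two_sub_one_le_doubleWell (x : ℝ) : x ^ 2 / 2 - 1 ≤ doubleWell x := by
  unfold doubleWell; nlinarith [sq_nonneg (x ^ 2 / 2 - 1)]

theorem integrable_exp_neg_doubleWell {ε : ℝ} (hε : 0 < ε) :
    Integrable fun x : ℝ => Real.exp (-doubleWell x / ε) := by
  refine ((integrable_exp_neg_sq_div hε).const_mul (Real.exp (1 / ε))).mono' ?_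
    (Filter.Eventually.of_forall fun x => ?_)
  · refine Continuous.aestronglyMeasurable ?_
    unfold doubleWell; fun_prop
  · rw [Real.norm_of_nonneg (Real.exp_pos _).le, ← Real.exp_add, Real.exp_le_exp]
    have := sq_div_two_sub_one_le_doubleWell x
    rw [show 1 / ε + -(1 / (2 * ε)) * x ^ 2 = -(x ^ 2 / 2 - 1) / ε by field_simp; ring]
    gcongr

theorem integral_sq_mul_exp_le {ε : ℝ} (hε : 0 < ε) :
    Integrable (fun x : ℝ => x ^ 2 * Real.exp (-(1 / (2 * ε)) * x ^ 2)) ∧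
      ∫ x : ℝ, x ^ 2 * Real.exp (-(1 / (2 * ε)) * x ^ 2) ≤ 6 * ε * √(2 * Real.pi * ε) := by
  have hpt : ∀ x : ℝ, x ^ 2 * Real.exp (-(1 / (2 * ε)) * x ^ 2) ≤
      4 * ε * Real.exp (-(1 / (2 * (2 * ε))) * x ^ 2) := fun x => by
    have h1 : x ^ 2 / (4 * ε) ≤ Real.exp (x ^ 2 / (4 * ε)) := by
      linarith [Real.add_one_le_exp (x ^ 2 / (4 * ε))]
    rw [div_le_iff₀ (by positivity)] at h1
    calc _ ≤ Real.exp (x ^ 2 / (4 * ε)) * (4 * ε) * Real.exp (-(1 / (2 * ε)) * x ^ 2) := by gcongr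
      _ = 4 * ε * (Real.exp (x ^ 2 / (4 * ε)) * Real.exp (-(1 / (2 * ε)) * x ^ 2)) := by ring
      _ = _ := by rw [← Real.exp_add]; congr 2; field_simp; ring
  have hi := (integrable_exp_neg_sq_div (by positivity : 0 < 2 * ε)).const_mul (4 * ε)
  have hI : Integrable (fun x : ℝ => x ^ 2 * Real.exp (-(1 / (2 * ε)) * x ^ 2)) := by
    refine hi.mono' (by fun_prop) (Filter.Eventually.of_forall fun x => ?_)
    rw [Real.norm_of_nonneg (by positivity)]
    exact hpt x
  refine ⟨hI, (integral_mono hI hi hpt).trans ?_⟩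
  rw [integral_const_mul, integral_exp_neg_sq_div (by positivity)]
  rw [show 2 * Real.pi * (2 * ε) = 2 * (2 * Real.pi * ε) by ring, Real.sqrt_mul (by norm_num)]
  have : √2 ≤ 3 / 2 := by rw [Real.sqrt_le_left (by norm_num)]; norm_num
  have h0 := Real.sqrt_nonneg (2 * Real.pi * ε)
  calc 4 * ε * (√2 * √(2 * Real.pi * ε)) ≤ 4 * ε * (3 / 2 * √(2 * Real.pi * ε)) := by gcongr
    _ = _ := by ring

/-- A profile whose primitive is nearly optimal for the one-dimensional capacity. -/
theorem exists_profile {a ε : ℝ} (ha : 0 < a) (hε : 0 < ε) (hs : 6 * ε / a ^ 2 < 1) :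
    ∃ ψ : ℝ → ℝ, Continuous ψ ∧ (∀ x, 0 ≤ ψ x) ∧ (∀ x, a ≤ |x| → ψ x = 0) ∧ ∫ x, ψ x = 1 ∧
      ∫ x, Real.exp (-doubleWell x / ε) * ψ x ^ 2 ≤
        1 / (√(2 * Real.pi * ε) * (1 - 6 * ε / a ^ 2)) := by
  set χ : ℝ → ℝ := fun x => max 0 (1 - x ^ 2 / a ^ 2) with hχ
  have hχ0 : ∀ x, 0 ≤ χ x := fun x => le_max_left _ _
  have hχ1 : ∀ x, χ x ≤ 1 := fun x => max_le zero_le_one (by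
    have : 0 ≤ x ^ 2 / a ^ 2 := by positivity
    linarith)
  have hχc : Continuous χ := by fun_prop
  set w : ℝ → ℝ := fun x => Real.exp (-(1 / (2 * ε)) * x ^ 2)
  have hwi : Integrable w := integrable_exp_neg_sq_div hε
  have hwc : Continuous w := by fun_prop
  have hw0 : ∀ x, 0 < w x := fun x => Real.exp_pos _
  have hχw : Integrable fun x => χ x * w x := by
    refine hwi.mono' (by fun_prop) (Filter.Eventually.of_forall fun x => ?_)
    rw [Real.norm_of_nonneg (mul_nonneg (hχ0 x) (hw0 x).le)]
    exact mul_le_of_le_one_left (hw0 x).le (hχ1 x)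
  set Z := ∫ x, χ x * w x with hZ
  obtain ⟨i2, b2⟩ := integral_sq_mul_exp_le hε
  have hz0 : 0 < √(2 * Real.pi * ε) := Real.sqrt_pos.2 (by positivity)
  have hZl : √(2 * Real.pi * ε) * (1 - 6 * ε / a ^ 2) ≤ Z := by
    have h1 : ∫ x, (w x - (a ^ 2)⁻¹ * (x ^ 2 * w x)) ≤ Z := by
      refine integral_mono (hwi.sub (i2.const_mul _)) hχw fun x => ?_
      have : 1 - x ^ 2 / a ^ 2 ≤ χ x := le_max_right _ _
      calc w x - (a ^ 2)⁻¹ * (x ^ 2 * w x) = (1 - x ^ 2 / a ^ 2) * w x := by ring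
        _ ≤ χ x * w x := mul_le_mul_of_nonneg_right this (hw0 x).le
    rw [integral_sub hwi (i2.const_mul _), integral_const_mul,
      show ∫ x, w x = √(2 * Real.pi * ε) from integral_exp_neg_sq_div hε] at h1
    refine le_trans ?_ h1
    have : (a ^ 2)⁻¹ * ∫ x, x ^ 2 * w x ≤ (a ^ 2)⁻¹ * (6 * ε * √(2 * Real.pi * ε)) := by
      gcongr
    calc _ = √(2 * Real.pi * ε) - (a ^ 2)⁻¹ * (6 * ε * √(2 * Real.pi * ε)) := by ring
      _ ≤ _ := by linarith
  have hZp : 0 < Z := lt_of_lt_of_le (mul_pos hz0 (by linarith)) hZl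
  refine ⟨fun x => Z⁻¹ * (χ x * w x), by fun_prop, fun x =>
    mul_nonneg (by positivity) (mul_nonneg (hχ0 x) (hw0 x).le), fun x hx => ?_, ?_, ?_⟩
  · have h1 : a ^ 2 ≤ x ^ 2 := by rw [← sq_abs x]; gcongr
    have : χ x = 0 := max_eq_left (by
      rw [sub_nonpos, le_div_iff₀ (by positivity)]; linarith)
    simp [this]
  · rw [integral_const_mul, ← hZ, inv_mul_cancel₀ hZp.ne']
  · calc ∫ x, Real.exp (-doubleWell x / ε) * (Z⁻¹ * (χ x * w x)) ^ 2
        ≤ ∫ x, Z⁻¹ ^ 2 * (χ x * w x) := by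
          refine integral_mono_of_nonneg (Filter.Eventually.of_forall fun x => by positivity)
            (hχw.const_mul _) (Filter.Eventually.of_forall fun x => ?_)
          have h1 : Real.exp (-doubleWell x / ε) * w x ≤ 1 := by
            rw [← Real.exp_add, Real.exp_le_one_iff]
            have := neg_sq_div_two_le_doubleWell x
            rw [show -doubleWell x / ε + -(1 / (2 * ε)) * x ^ 2 =
              -(doubleWell x - -(x ^ 2 / 2)) / ε by field_simp; ring]
            exact div_nonpos_of_nonpos_of_nonneg (by linarith) hε.le
          have h2 := hχ0 x
          have h3 := hχ1 x
          have h4 := hw0 x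
          calc Real.exp (-doubleWell x / ε) * (Z⁻¹ * (χ x * w x)) ^ 2
              = Z⁻¹ ^ 2 * (χ x * w x) * (χ x * (Real.exp (-doubleWell x / ε) * w x)) := by ring
            _ ≤ Z⁻¹ ^ 2 * (χ x * w x) * (1 * 1) := by gcongr
            _ = _ := by ring
      _ = 1 / Z := by rw [integral_const_mul, ← hZ]; field_simp
      _ ≤ _ := one_div_le_one_div_of_le (mul_pos hz0 (by linarith)) hZl

end OneDimensional

section Upper

variable {N : ℕ} [NeZero N]

theorem exists_fluctMeasure (N : ℕ) [NeZero N] :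
    ∃ ν : Measure (EuclideanSpace ℝ (ZMod N)),
      (∀ (f : ℝ → ℝ) (k : EuclideanSpace ℝ (ZMod N) → ℝ),
        ∫ u, f (mean N u) * k (fluct u) = (∫ x, f x) * ∫ v, k v ∂ν) ∧
      ∀ (f : ℝ → ℝ) (k : EuclideanSpace ℝ (ZMod N) → ℝ), Integrable f → Integrable k ν →
        Integrable fun u => f (mean N u) * k (fluct u) :=
  exists_measure_integral_mul_eq (mean N) (constConfig N 1) (mean_constConfig 1)

/-- The law of the fluctuations under Lebesgue measure conditioned on the mean. -/
def fluctMeasure (N : ℕ) [NeZero N] : Measure (EuclideanSpace ℝ (ZMod N)) :=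
  (exists_fluctMeasure N).choose

theorem integral_mean_mul_fluct (f : ℝ → ℝ) (k : EuclideanSpace ℝ (ZMod N) → ℝ) :
    ∫ u, f (mean N u) * k (fluct u) = (∫ x, f x) * ∫ v, k v ∂(fluctMeasure N) :=
  (exists_fluctMeasure N).choose_spec.1 f k

theorem integrable_mean_mul_fluct {f : ℝ → ℝ} {k : EuclideanSpace ℝ (ZMod N) → ℝ}
    (hf : Integrable f) (hk : Integrable k (fluctMeasure N)) :
    Integrable fun u => f (mean N u) * k (fluct u) :=
  (exists_fluctMeasure N).choose_spec.2 f k hf hk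

theorem sqrt_mul_integral_fluctWeight (hN : 2 ≤ N) {μ ε : ℝ} (hμ : 1 < μ) (hε : 0 < ε) :
    √(2 * Real.pi * ε) * ∫ v, fluctWeight N (μ * couplingThreshold N) ε v ∂(fluctMeasure N) =
      gaussMass N (μ * couplingThreshold N) ε := by
  rw [← integral_exp_mul_fluctWeight hN hμ hε, ← integral_exp_neg_sq_div hε,
    ← integral_mean_mul_fluct]

theorem integrable_fluctWeight (hN : 2 ≤ N) {μ ε : ℝ} (hμ : 1 < μ) (hε : 0 < ε) :
    Integrable (fluctWeight N (μ * couplingThreshold N) ε) (fluctMeasure N) := by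
  refine Integrable.of_integral_ne_zero fun h => ?_
  have h1 := sqrt_mul_integral_fluctWeight hN hμ hε
  rw [h, mul_zero] at h1
  exact (gaussMass_pos hN hμ hε).ne h1

theorem exp_neg_rescaledPotential_le (γ : ℝ) {ε : ℝ} (hε : 0 < ε)
    (u : EuclideanSpace ℝ (ZMod N)) :
    Real.exp (-rescaledPotential N γ u / ε) ≤
      Real.exp (-doubleWell (mean N u) / ε) * fluctWeight N γ ε (fluct u) := by
  have hN := natCast_pos_of_neZero N
  rw [fluctWeight, ← Real.exp_add, Real.exp_le_exp,
    show -doubleWell (mean N u) / ε + -(hessianForm N γ (fluct u) / (2 * N * ε)) =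
      -(doubleWell (mean N u) + hessianForm N γ (fluct u) / (2 * N)) / ε by field_simp; ring]
  have := le_rescaledPotential γ u
  gcongr

theorem continuous_rescaledPotential (γ : ℝ) : Continuous (rescaledPotential N γ) := by
  unfold rescaledPotential potential; fun_prop

theorem isFiniteMeasure_gibbsMeasure (hN : 2 ≤ N) {μ ε : ℝ} (hμ : 1 < μ) (hε : 0 < ε) :
    IsFiniteMeasure (gibbsMeasure (rescaledPotential N (μ * couplingThreshold N)) ε) := by
  have hi := integrable_mean_mul_fluct (integrable_exp_neg_doubleWell hε)
    (integrable_fluctWeight hN hμ hε)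
  have hc := continuous_rescaledPotential (N := N) (μ * couplingThreshold N)
  have h : Integrable fun u => Real.exp (-rescaledPotential N (μ * couplingThreshold N) u / ε) := by
    refine hi.mono' (by fun_prop) (Filter.Eventually.of_forall fun u => ?_)
    rw [Real.norm_of_nonneg (Real.exp_pos _).le]
    exact exp_neg_rescaledPotential_le _ hε u
  exact isFiniteMeasure_withDensity_ofReal h.2

theorem norm_constConfig_one_sq : ‖constConfig N 1‖ ^ 2 = N := by
  rw [EuclideanSpace.real_norm_sq_eq]; simp [constConfig]

theorem inner_constConfig_one (v : EuclideanSpace ℝ (ZMod N)) :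
    inner ℝ (constConfig N 1) v = N * mean N v := by
  have := (natCast_pos_of_neZero N).ne'
  rw [mean_apply, mul_inv_cancel_left₀ this]
  simp [PiLp.inner_apply, constConfig]

/-- The primitive of a continuous profile, as a function of the mean, is admissible. -/
theorem isAdmissible_primitive (hN : 2 ≤ N) {μ ε ρ : ℝ} (hμ : 1 < μ) (hε : 0 < ε) (hρ₀ : 0 < ρ)
    (hρ₁ : ρ < 1) {ψ : ℝ → ℝ} (hψ : Continuous ψ) (hψ0 : ∀ x, 0 ≤ ψ x)
    (hψs : ∀ x, 1 - ρ ≤ |x| → ψ x = 0) (hψ1 : ∫ x, ψ x = 1) :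
    IsAdmissible (rescaledPotential N (μ * couplingThreshold N)) ε
      (Metric.ball (constConfig N 1) (ρ * √(N : ℝ))) (Metric.ball (constConfig N (-1)) (ρ * √(N : ℝ)))
      (fun u => ∫ x in (-(1 - ρ))..(mean N u), ψ x)
      (fun u => ψ (mean N u) • ((N : ℝ)⁻¹ • constConfig N 1)) := by
  have hN0 := natCast_pos_of_neZero N
  set a := 1 - ρ with ha
  have ha0 : 0 < a := by linarith
  set Φ : ℝ → ℝ := fun y => ∫ x in (-a)..y, ψ x with hΦ
  have hd : ∀ y, HasDerivAt Φ (ψ y) y := fun y => hψ.integral_hasStrictDerivAt (-a) y |>.hasDerivAt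
  have hΦc : Continuous Φ := continuous_iff_continuousAt.2 fun y => (hd y).continuousAt
  have hmono : Monotone Φ := monotone_of_hasDerivAt_nonneg (fun y => hd y) hψ0
  have hlow : ∀ y, y ≤ -a → Φ y = 0 := fun y hy => by
    simp only [hΦ]
    rw [intervalIntegral.integral_congr (g := fun _ => 0), intervalIntegral.integral_zero]
    intro x hx
    rw [Set.uIcc_of_ge hy] at hx
    exact hψs x (by rw [abs_of_nonpos (by linarith [hx.2])]; linarith [hx.2])
  have htop : Φ a = 1 := by
    simp only [hΦ]
    rw [intervalIntegral.integral_of_le (by linarith), ← hψ1]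
    refine setIntegral_eq_integral_of_forall_compl_eq_zero fun x hx => hψs x ?_
    by_contra hcon
    push Not at hcon
    rw [abs_lt] at hcon
    exact hx ⟨hcon.1, hcon.2.le⟩
  have hhigh : ∀ y, a ≤ y → Φ y = 1 := fun y hy => by
    rw [← htop]
    simp only [hΦ]
    rw [← intervalIntegral.integral_add_adjacent_intervals (b := a)
      (hψ.intervalIntegrable _ _) (hψ.intervalIntegrable _ _)]
    rw [intervalIntegral.integral_congr (a := a) (b := y) (g := fun _ => 0),
      intervalIntegral.integral_zero, add_zero]
    intro x hx
    rw [Set.uIcc_of_le hy] at hx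
    exact hψs x (by rw [abs_of_nonneg (by linarith [hx.1])]; exact hx.1)
  have hIcc : ∀ y, Φ y ∈ Set.Icc (0 : ℝ) 1 := fun y => by
    constructor
    · rw [← hlow (min y (-a)) (min_le_right _ _)]; exact hmono (min_le_left _ _)
    · rw [← hhigh (max y a) (le_max_right _ _)]; exact hmono (le_max_left _ _)
  have hfd : ∀ u, HasFDerivAt (fun u => Φ (mean N u)) (ψ (mean N u) • mean N) u := fun u =>
    (hd (mean N u)).comp_hasFDerivAt u (mean N).hasFDerivAt
  have hhc : Continuous fun u => Φ (mean N u) := hΦc.comp (mean N).continuous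
  have hgc : Continuous fun u => ψ (mean N u) • ((N : ℝ)⁻¹ • constConfig N 1) :=
    (hψ.comp (mean N).continuous).smul continuous_const
  have hfin := isFiniteMeasure_gibbsMeasure hN hμ hε
  refine ⟨⟨hhc.locallyIntegrable, hgc.locallyIntegrable, fun φ hφ hφc v => ?_⟩, ?_, ?_, fun u =>
    hIcc _, fun u hu => ?_, fun u hu => ?_⟩
  · have hφd : Differentiable ℝ φ := hφ.differentiable (by simp)
    have hφ' : Continuous fun u => fderiv ℝ φ u v :=
      (hφ.continuous_fderiv (by simp)).clm_apply continuous_const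
    have hφs : HasCompactSupport fun u => fderiv ℝ φ u v := hφc.fderiv_apply ℝ v
    have hfd' : ∀ u, fderiv ℝ (fun u => Φ (mean N u)) u v = ψ (mean N u) * mean N v := fun u => by
      rw [(hfd u).fderiv]; simp
    have h := integral_mul_fderiv_eq_neg_fderiv_mul_of_integrable (μ := volume) (𝕜 := ℝ)
      (f := fun u => Φ (mean N u)) (g := φ) (v := v) ?_ ?_ ?_
      (fun x _ => (hfd x).differentiableAt) (fun x _ => hφd x)
    · rw [h]
      congr 1
      refine integral_congr_ae (Filter.Eventually.of_forall fun u => ?_)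
      simp only [hfd']
      rw [inner_smul_left, inner_smul_left, inner_constConfig_one]
      simp
      field_simp
    · simp only [hfd']
      exact (((hψ.comp (mean N).continuous).mul continuous_const).mul
        hφ.continuous).integrable_of_hasCompactSupport hφc.mul_left
    · exact (hhc.mul hφ').integrable_of_hasCompactSupport hφs.mul_left
    · exact (hhc.mul hφ.continuous).integrable_of_hasCompactSupport hφc.mul_left
  · refine MemLp.of_bound hhc.aestronglyMeasurable 1 (Filter.Eventually.of_forall fun u => ?_)
    rw [Real.norm_of_nonneg (hIcc _).1]
    exact (hIcc _).2
  · have hcs : HasCompactSupport ψ := HasCompactSupport.intro (isCompact_Icc (a := -a) (b := a))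
      fun x hx => hψs x (by
        by_contra hcon
        push Not at hcon
        rw [abs_lt] at hcon
        exact hx ⟨hcon.1.le, hcon.2.le⟩)
    obtain ⟨C, hC⟩ := hcs.exists_bound_of_continuous hψ
    refine MemLp.of_bound hgc.aestronglyMeasurable (C * ‖(N : ℝ)⁻¹ • constConfig N 1‖)
      (Filter.Eventually.of_forall fun u => ?_)
    rw [norm_smul]
    gcongr
    exact hC _
  · rw [mem_ball_constConfig_iff hρ₀] at hu
    have h2 := secondMoment_nonneg (fluct u)
    have := abs_lt_of_sq_lt_sq (by linarith : (mean N u - 1) ^ 2 < ρ ^ 2) hρ₀.le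
    rw [abs_lt] at this
    exact hhigh _ (by linarith)
  · rw [mem_ball_constConfig_iff hρ₀] at hu
    have h2 := secondMoment_nonneg (fluct u)
    have := abs_lt_of_sq_lt_sq (by linarith : (mean N u - -1) ^ 2 < ρ ^ 2) hρ₀.le
    rw [abs_lt] at this
    exact hlow _ (by linarith)

theorem capacity_le (hN : 2 ≤ N) {μ ε ρ : ℝ} (hμ : 1 < μ) (hε : 0 < ε) (hρ₀ : 0 < ρ)
    (hρ₁ : ρ < 1) (hs : 6 * ε / (1 - ρ) ^ 2 < 1) :
    (∃ h g, IsAdmissible (rescaledPotential N (μ * couplingThreshold N)) ε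
      (Metric.ball (constConfig N 1) (ρ * √(N : ℝ)))
      (Metric.ball (constConfig N (-1)) (ρ * √(N : ℝ))) h g) ∧
    capacity (rescaledPotential N (μ * couplingThreshold N)) ε
      (Metric.ball (constConfig N 1) (ρ * √(N : ℝ)))
      (Metric.ball (constConfig N (-1)) (ρ * √(N : ℝ))) ≤
      ε * gaussMass N (μ * couplingThreshold N) ε / (N * (2 * Real.pi * ε)) *
        (1 / (1 - 6 * ε / (1 - ρ) ^ 2)) := by
  have hN0 := natCast_pos_of_neZero N
  have hpi := Real.pi_pos
  obtain ⟨ψ, hψ, hψ0, hψs, hψ1, hψE⟩ := exists_profile (by linarith : 0 < 1 - ρ) hε hs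
  have hadm := isAdmissible_primitive hN hμ hε hρ₀ hρ₁ hψ hψ0 hψs hψ1
  set γ := μ * couplingThreshold N
  set A := Metric.ball (constConfig N 1) (ρ * √(N : ℝ))
  set D := Metric.ball (constConfig N (-1)) (ρ * √(N : ℝ))
  refine ⟨⟨_, _, hadm⟩, ?_⟩
  have hbdd : BddBelow {c : ℝ | ∃ h g, IsAdmissible (rescaledPotential N γ) ε A D h g ∧
      c = dirichletForm (rescaledPotential N γ) ε A D g} := by
    refine ⟨0, ?_⟩
    rintro c ⟨h, g, -, rfl⟩
    exact mul_nonneg hε.le (integral_nonneg fun u => by positivity)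
  refine (csInf_le hbdd ⟨_, _, hadm, rfl⟩).trans ?_
  have hψc : HasCompactSupport ψ := HasCompactSupport.intro
    (isCompact_Icc (a := -(1 - ρ)) (b := 1 - ρ)) fun x hx => hψs x (by
      by_contra hcon
      push Not at hcon
      rw [abs_lt] at hcon
      exact hx ⟨hcon.1.le, hcon.2.le⟩)
  have hfi : Integrable fun x => Real.exp (-doubleWell x / ε) * ψ x ^ 2 := by
    refine Continuous.integrable_of_hasCompactSupport ?_ ?_
    · unfold doubleWell; fun_prop
    · refine HasCompactSupport.mul_left ?_
      exact hψc.comp_left (g := fun y : ℝ => y ^ 2) (by simp)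
  have hprod := integrable_mean_mul_fluct hfi (integrable_fluctWeight hN hμ hε)
  set Zν := ∫ v, fluctWeight N γ ε v ∂(fluctMeasure N)
  have hZ : √(2 * Real.pi * ε) * Zν = gaussMass N γ ε := sqrt_mul_integral_fluctWeight hN hμ hε
  have hz0 : 0 < √(2 * Real.pi * ε) := Real.sqrt_pos.2 (by positivity)
  have hZν : 0 < Zν := by
    have := gaussMass_pos (ε := ε) hN hμ hε
    rw [← hZ] at this
    exact (mul_pos_iff_of_pos_left hz0).1 this
  have hle : ∫ u in (A ∪ D)ᶜ, Real.exp (-rescaledPotential N γ u / ε) *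
      ‖ψ (mean N u) • ((N : ℝ)⁻¹ • constConfig N 1)‖ ^ 2 ≤
      (N : ℝ)⁻¹ * ∫ u, (Real.exp (-doubleWell (mean N u) / ε) * ψ (mean N u) ^ 2) *
        fluctWeight N γ ε (fluct u) := by
    rw [← integral_const_mul]
    have hint := hprod.const_mul (N : ℝ)⁻¹
    refine (integral_mono_of_nonneg (Filter.Eventually.of_forall fun u => by positivity)
      hint.integrableOn (Filter.Eventually.of_forall fun u => ?_)).trans
      (setIntegral_le_integral hint (Filter.Eventually.of_forall fun u => ?_))
    · have h1 := exp_neg_rescaledPotential_le γ hε u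
      have h2 : ‖ψ (mean N u) • ((N : ℝ)⁻¹ • constConfig N 1)‖ ^ 2 =
          (N : ℝ)⁻¹ * ψ (mean N u) ^ 2 := by
        rw [norm_smul, norm_smul, mul_pow, mul_pow, norm_constConfig_one_sq, Real.norm_eq_abs,
          Real.norm_eq_abs, sq_abs, sq_abs]
        field_simp
      simp only [h2]
      calc _ ≤ (Real.exp (-doubleWell (mean N u) / ε) * fluctWeight N γ ε (fluct u)) *
            ((N : ℝ)⁻¹ * ψ (mean N u) ^ 2) := by gcongr
        _ = _ := by ring
    · simp only [Pi.zero_apply, fluctWeight]; positivity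
  rw [integral_mean_mul_fluct (fun x => Real.exp (-doubleWell x / ε) * ψ x ^ 2)] at hle
  calc dirichletForm (rescaledPotential N γ) ε A D _ ≤
        ε * ((N : ℝ)⁻¹ * (1 / (√(2 * Real.pi * ε) * (1 - 6 * ε / (1 - ρ) ^ 2)) * Zν)) := by
        refine mul_le_mul_of_nonneg_left (hle.trans ?_) hε.le
        gcongr
    _ = _ := by
        rw [← hZ]
        rw [show (N : ℝ) * (2 * Real.pi * ε) = N * √(2 * Real.pi * ε) ^ 2 by
          rw [Real.sq_sqrt (by positivity)]]
        have : 1 - 6 * ε / (1 - ρ) ^ 2 ≠ 0 := by linarith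
        field_simp

end Upper

section BarrierIntegral

theorem exp_le_one_add_mul_exp (t : ℝ) : Real.exp t ≤ 1 + t * Real.exp t := by
  have h := Real.add_one_le_exp (-t)
  have h2 : Real.exp (-t) * Real.exp t = 1 := by rw [← Real.exp_add]; simp
  nlinarith [Real.exp_pos t]

/-- The one-dimensional barrier weight, with a quadratic perturbation of relative size `√ε`. -/
def barrierWeight (ε x : ℝ) : ℝ :=
  (Set.Icc (-1 : ℝ) 1).indicator
    (fun x => Real.exp ((doubleWell x + 2 * x ^ 2 * √ε) / ε)) x

theorem barrierWeight_nonneg (ε x : ℝ) : 0 ≤ barrierWeight ε x :=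
  Set.indicator_nonneg (fun _ _ => (Real.exp_pos _).le) x

theorem integrable_barrierWeight (ε : ℝ) : Integrable (barrierWeight ε) := by
  have hc : Continuous fun x => Real.exp ((doubleWell x + 2 * x ^ 2 * √ε) / ε) := by
    unfold doubleWell; fun_prop
  exact (hc.integrableOn_Icc).integrable_indicator measurableSet_Icc

theorem integral_barrierWeight_pos (ε : ℝ) : 0 < ∫ x, barrierWeight ε x := by
  have hc : Continuous fun x => Real.exp ((doubleWell x + 2 * x ^ 2 * √ε) / ε) := by
    unfold doubleWell; fun_prop
  rw [integral_pos_iff_support_of_nonneg (barrierWeight_nonneg ε) (integrable_barrierWeight ε)]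
  have : Set.Icc (-1 : ℝ) 1 ⊆ Function.support (barrierWeight ε) := fun x hx => by
    rw [Function.mem_support, barrierWeight, Set.indicator_of_mem hx]
    exact (Real.exp_pos _).ne'
  refine lt_of_lt_of_le ?_ (measure_mono this)
  simp

theorem barrierWeight_le {ε : ℝ} (hε : 0 < ε) (hδ : √ε ≤ 1 / 16) (x : ℝ) :
    barrierWeight ε x ≤ Real.exp (-(1 / (2 * (ε / (1 - 4 * √ε)))) * x ^ 2) +
      128 * ε * Real.exp (-(1 / (2 * (8 * ε))) * x ^ 2) := by
  by_cases hx : x ∈ Set.Icc (-1 : ℝ) 1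
  swap
  · rw [barrierWeight, Set.indicator_of_notMem hx]; positivity
  rw [barrierWeight, Set.indicator_of_mem hx]
  set δ := √ε
  have hx2 : x ^ 2 ≤ 1 := by nlinarith [hx.1, hx.2]
  have hx4 : x ^ 4 ≤ x ^ 2 := by nlinarith [sq_nonneg x]
  have h14 : 0 < 1 - 4 * δ := by linarith
  have e1 : (doubleWell x + 2 * x ^ 2 * δ) / ε =
      x ^ 4 / (4 * ε) + -(1 / (2 * (ε / (1 - 4 * δ)))) * x ^ 2 := by
    unfold doubleWell; field_simp; ring
  rw [e1, Real.exp_add]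
  have h1 := exp_le_one_add_mul_exp (x ^ 4 / (4 * ε))
  set w := Real.exp (-(1 / (2 * (ε / (1 - 4 * δ)))) * x ^ 2) with hw
  have h2 : Real.exp (x ^ 4 / (4 * ε)) * w ≤ Real.exp (-(x ^ 2 / (8 * ε))) := by
    rw [hw, ← Real.exp_add, Real.exp_le_exp]
    rw [show x ^ 4 / (4 * ε) + -(1 / (2 * (ε / (1 - 4 * δ)))) * x ^ 2 =
      (2 * x ^ 4 - 4 * (1 - 4 * δ) * x ^ 2) / (8 * ε) by field_simp; ring, ← neg_div]
    gcongr
    nlinarith [sq_nonneg x]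
  have h3 : x ^ 4 ≤ 512 * ε ^ 2 * Real.exp (x ^ 2 / (16 * ε)) := by
    have := Real.pow_div_factorial_le_exp (x ^ 2 / (16 * ε)) (by positivity) 2
    rw [show (x ^ 2 / (16 * ε)) ^ 2 / (Nat.factorial 2 : ℕ) = x ^ 4 / (512 * ε ^ 2) by
      simp [Nat.factorial]; field_simp; ring] at this
    rw [div_le_iff₀ (by positivity)] at this
    linarith
  have h4 : Real.exp (-(1 / (2 * (8 * ε))) * x ^ 2) =
      Real.exp (x ^ 2 / (16 * ε)) * Real.exp (-(x ^ 2 / (8 * ε))) := by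
    rw [← Real.exp_add]; congr 1; field_simp; ring
  have hw0 : 0 < w := Real.exp_pos _
  calc Real.exp (x ^ 4 / (4 * ε)) * w
      ≤ (1 + x ^ 4 / (4 * ε) * Real.exp (x ^ 4 / (4 * ε))) * w := by gcongr
    _ = w + x ^ 4 / (4 * ε) * (Real.exp (x ^ 4 / (4 * ε)) * w) := by ring
    _ ≤ w + (512 * ε ^ 2 * Real.exp (x ^ 2 / (16 * ε))) / (4 * ε) *
        Real.exp (-(x ^ 2 / (8 * ε))) := by gcongr
    _ = _ := by rw [h4]; field_simp; ring

theorem integral_barrierWeight_le {ε : ℝ} (hε : 0 < ε) (hδ : √ε ≤ 1 / 16) :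
    ∫ x, barrierWeight ε x ≤ √(2 * Real.pi * ε) * (1 + 28 * √ε) := by
  have hpi := Real.pi_pos
  have hδ0 : 0 ≤ √ε := Real.sqrt_nonneg _
  have hsq : √ε ^ 2 = ε := Real.sq_sqrt hε.le
  have h14 : 0 < 1 - 4 * √ε := by linarith
  have i1 := integrable_exp_neg_sq_div (ε := ε / (1 - 4 * √ε)) (by positivity)
  have i2 := (integrable_exp_neg_sq_div (ε := 8 * ε) (by positivity)).const_mul (128 * ε)
  refine (integral_mono (integrable_barrierWeight ε) (i1.add i2) (barrierWeight_le hε hδ)).trans ?_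
  rw [integral_add' i1 i2, integral_const_mul,
    integral_exp_neg_sq_div (ε := ε / (1 - 4 * √ε)) (by positivity),
    integral_exp_neg_sq_div (ε := 8 * ε) (by positivity)]
  set z₀ := √(2 * Real.pi * ε) with hz₀
  have hz : z₀ ^ 2 = 2 * Real.pi * ε := Real.sq_sqrt (by positivity)
  have hz0 : 0 ≤ z₀ := Real.sqrt_nonneg _
  have b1 : √(2 * Real.pi * (ε / (1 - 4 * √ε))) ≤ z₀ * (1 + 4 * √ε) := by
    refine Real.sqrt_le_iff.2 ⟨by positivity, ?_⟩
    rw [mul_pow, hz, ← mul_div_assoc, div_le_iff₀ h14, mul_assoc (2 * Real.pi * ε)]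
    have h0 : 0 ≤ 2 * Real.pi * ε := by positivity
    refine le_mul_of_one_le_right h0 ?_
    nlinarith [mul_nonneg hδ0 hδ0]
  have b2 : √(2 * Real.pi * (8 * ε)) ≤ z₀ * 3 := by
    refine Real.sqrt_le_iff.2 ⟨by positivity, ?_⟩
    rw [mul_pow, hz]
    nlinarith [mul_pos hpi hε]
  calc _ ≤ z₀ * (1 + 4 * √ε) + 128 * ε * (z₀ * 3) := by gcongr
    _ = z₀ * (1 + 4 * √ε + 384 * (√ε * √ε)) := by rw [← pow_two, hsq]; ring
    _ ≤ z₀ * (1 + 28 * √ε) := mul_le_mul_of_nonneg_left (by nlinarith) hz0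

end BarrierIntegral

section WeakGradient

variable {ι : Type*} [Fintype ι]

theorem integral_fderiv_apply_eq_zero {φ : EuclideanSpace ℝ ι → ℝ}
    (hφ : ContDiff ℝ ((⊤ : ℕ∞) : WithTop ℕ∞) φ) (hφc : HasCompactSupport φ)
    (v : EuclideanSpace ℝ ι) : ∫ u, fderiv ℝ φ u v = 0 := by
  have hφ' : Continuous fun u => fderiv ℝ φ u v :=
    (hφ.continuous_fderiv (by simp)).clm_apply continuous_const
  have h := integral_mul_fderiv_eq_neg_fderiv_mul_of_integrable (μ := volume) (𝕜 := ℝ)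
    (f := fun _ : EuclideanSpace ℝ ι => (1 : ℝ)) (g := φ) (v := v) (by simp)
    (by simpa using hφ'.integrable_of_hasCompactSupport (hφc.fderiv_apply ℝ v))
    (by simpa using hφ.continuous.integrable_of_hasCompactSupport hφc)
    (fun x _ => by fun_prop) (fun x _ => hφ.differentiable (by simp) x)
  simpa using h

/-- A weak gradient vanishes almost everywhere on open sets where the function is constant. -/
theorem IsWeakGradient.ae_eq_zero_of_const {h : EuclideanSpace ℝ ι → ℝ}
    {g : EuclideanSpace ℝ ι → EuclideanSpace ℝ ι} (hg : IsWeakGradient h g)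
    {U : Set (EuclideanSpace ℝ ι)} (hU : IsOpen U) {c : ℝ} (hc : ∀ u ∈ U, h u = c) :
    ∀ᵐ u, u ∈ U → g u = 0 := by
  refine hU.ae_eq_zero_of_integral_contDiff_smul_eq_zero
    (hg.locallyIntegrable_grad.locallyIntegrableOn U) fun φ hφ hφc hφU => ?_
  have hint : Integrable fun u => φ u • g u :=
    hg.locallyIntegrable_grad.integrable_smul_left_of_hasCompactSupport hφ.continuous hφc
  refine ext_inner_right ℝ fun v => ?_
  rw [inner_zero_left, real_inner_comm, ← integral_inner hint]
  have h1 := hg.integral_eq φ hφ hφc v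
  have h2 : ∫ u, h u * fderiv ℝ φ u v = ∫ u, c * fderiv ℝ φ u v := by
    refine integral_congr_ae (Filter.Eventually.of_forall fun u => ?_)
    by_cases hu : u ∈ tsupport φ
    · simp only [hc u (hφU hu)]
    · have : fderiv ℝ φ u = 0 := by
        by_contra hne
        exact hu (support_fderiv_subset ℝ hne)
      simp [this]
  rw [h2, integral_const_mul, integral_fderiv_apply_eq_zero hφ hφc, mul_zero] at h1
  rw [← neg_eq_zero, h1]
  congr 2
  ext u
  rw [inner_smul_right, real_inner_comm]

/-- The dual lower bound for the Dirichlet form given by a test function. -/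
theorem two_mul_integral_le_dirichlet {V : EuclideanSpace ℝ ι → ℝ} (hV : Continuous V) {ε : ℝ}
    {A D : Set (EuclideanSpace ℝ ι)} (hA : IsOpen A) (hD : IsOpen D)
    {h : EuclideanSpace ℝ ι → ℝ} {g : EuclideanSpace ℝ ι → EuclideanSpace ℝ ι}
    (hadm : IsAdmissible V ε A D h g) {φ : EuclideanSpace ℝ ι → ℝ} (hφ : Continuous φ)
    (hφc : HasCompactSupport φ) (e : EuclideanSpace ℝ ι) {s : ℝ} (hs : 0 < s) :
    2 * ∫ u, φ u * inner ℝ (g u) e ≤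
      s * ‖e‖ ^ 2 * (∫ u in (A ∪ D)ᶜ, Real.exp (-V u / ε) * ‖g u‖ ^ 2) +
        s⁻¹ * ∫ u, Real.exp (V u / ε) * φ u ^ 2 := by
  have hg := hadm.isWeakGradient
  have i1 : Integrable fun u => φ u * inner ℝ (g u) e := by
    have : Integrable fun u => φ u • g u :=
      hg.locallyIntegrable_grad.integrable_smul_left_of_hasCompactSupport hφ hφc
    refine (this.inner_const e).congr (Filter.Eventually.of_forall fun u => ?_)
    simp [inner_smul_left]
  have i2 : Integrable fun u => Real.exp (-V u / ε) * ‖g u‖ ^ 2 := by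
    have h1 := hadm.memLp_grad.integrable_norm_pow (p := 2) (by norm_num)
    rw [gibbsMeasure, integrable_withDensity_iff_integrable_smul' (by fun_prop)
      (Filter.Eventually.of_forall fun u => ENNReal.ofReal_lt_top)] at h1
    refine h1.congr (Filter.Eventually.of_forall fun u => ?_)
    simp [ENNReal.toReal_ofReal (Real.exp_pos _).le]
  have i3 : Integrable fun u => Real.exp (V u / ε) * φ u ^ 2 := by
    refine Continuous.integrable_of_hasCompactSupport (by fun_prop) ?_
    exact (hφc.comp_left (g := fun y : ℝ => y ^ 2) (by simp)).mul_left
  have hmeas : MeasurableSet (A ∪ D)ᶜ := (hA.union hD).measurableSet.compl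
  have h0 : ∫ u, φ u * inner ℝ (g u) e = ∫ u in (A ∪ D)ᶜ, φ u * inner ℝ (g u) e := by
    rw [← integral_indicator hmeas]
    refine integral_congr_ae ?_
    filter_upwards [hg.ae_eq_zero_of_const hA hadm.eq_one,
      hg.ae_eq_zero_of_const hD hadm.eq_zero] with u h1 h2
    by_cases hu : u ∈ (A ∪ D)ᶜ
    · rw [Set.indicator_of_mem hu]
    · rw [Set.indicator_of_notMem hu]
      rcases (Set.notMem_compl_iff.1 hu) with h | h
      · simp [h1 h]
      · simp [h2 h]
  rw [h0, ← integral_const_mul, ← integral_const_mul, ← integral_const_mul]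
  calc ∫ u in (A ∪ D)ᶜ, 2 * (φ u * inner ℝ (g u) e)
      ≤ ∫ u in (A ∪ D)ᶜ, (s * ‖e‖ ^ 2 * (Real.exp (-V u / ε) * ‖g u‖ ^ 2) +
          s⁻¹ * (Real.exp (V u / ε) * φ u ^ 2)) := by
        refine integral_mono (i1.const_mul 2).integrableOn
          ((i2.const_mul _).add (i3.const_mul _)).integrableOn fun u => ?_
        set w := Real.exp (-V u / ε)
        have hw : 0 < w := Real.exp_pos _
        have hw' : Real.exp (V u / ε) = w⁻¹ := by
          rw [← Real.exp_neg]; congr 1; ring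
        set x := inner ℝ (g u) e
        have hx : x ^ 2 ≤ ‖e‖ ^ 2 * ‖g u‖ ^ 2 := by
          rw [← mul_pow, mul_comm, ← sq_abs x]
          gcongr
          exact abs_real_inner_le_norm _ _
        have h5 : 2 * (φ u * x) ≤ s * w * x ^ 2 + s⁻¹ * (w⁻¹ * φ u ^ 2) := by
          have : s * w * x ^ 2 + s⁻¹ * (w⁻¹ * φ u ^ 2) - 2 * (φ u * x) =
              s⁻¹ * w⁻¹ * (s * w * x - φ u) ^ 2 := by field_simp; ring
          have h6 : 0 ≤ s⁻¹ * w⁻¹ * (s * w * x - φ u) ^ 2 := by positivity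
          linarith
        simp only [hw']
        refine h5.trans ?_
        gcongr ?_ + _
        calc s * w * x ^ 2 ≤ s * w * (‖e‖ ^ 2 * ‖g u‖ ^ 2) := by gcongr
          _ = _ := by ring
    _ ≤ _ := by
        rw [integral_add (i2.const_mul _).integrableOn (i3.const_mul _).integrableOn]
        gcongr ?_ + ?_
        · exact le_rfl
        · refine setIntegral_le_integral (i3.const_mul _) (Filter.Eventually.of_forall fun u => ?_)
          simp only [Pi.zero_apply]; positivity

end WeakGradient

section Lower

variable {N : ℕ} [NeZero N]

/-- The cutoff of the mean in the test flow. -/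
def meanCutoff (ρ x : ℝ) : ℝ := Real.smoothTransition (2 * (1 - x ^ 2) / ρ)

theorem contDiff_meanCutoff (ρ : ℝ) : ContDiff ℝ ((⊤ : ℕ∞) : WithTop ℕ∞) (meanCutoff ρ) :=
  Real.smoothTransition.contDiff.comp (by fun_prop)

theorem meanCutoff_eq_zero {ρ x : ℝ} (hρ : 0 < ρ) (hx : 1 ≤ x ^ 2) : meanCutoff ρ x = 0 :=
  Real.smoothTransition.zero_of_nonpos
    (div_nonpos_of_nonpos_of_nonneg (by linarith) hρ.le)

theorem meanCutoff_eq_one {ρ x : ℝ} (hρ : 0 < ρ) (hx : x ^ 2 ≤ 1 - ρ / 2) :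
    meanCutoff ρ x = 1 :=
  Real.smoothTransition.one_of_one_le (by rw [le_div_iff₀ hρ]; linarith)

theorem mem_of_deriv_meanCutoff_ne_zero {ρ x : ℝ} (hρ : 0 < ρ) (hx : deriv (meanCutoff ρ) x ≠ 0) :
    1 - ρ / 2 ≤ x ^ 2 ∧ x ^ 2 ≤ 1 := by
  constructor
  · by_contra! hlt
    apply hx
    have : meanCutoff ρ =ᶠ[nhds x] fun _ => 1 := by
      filter_upwards [(isOpen_lt (continuous_pow 2) continuous_const).mem_nhds hlt] with y hy
      exact meanCutoff_eq_one hρ (le_of_lt hy)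
    rw [this.deriv_eq, deriv_const]
  · by_contra! hlt
    apply hx
    have : meanCutoff ρ =ᶠ[nhds x] fun _ => 0 := by
      filter_upwards [(isOpen_lt continuous_const (continuous_pow 2)).mem_nhds hlt] with y hy
      exact meanCutoff_eq_zero hρ (le_of_lt hy)
    rw [this.deriv_eq, deriv_const]

theorem integral_deriv_meanCutoff {ρ : ℝ} (hρ₀ : 0 < ρ) (hρ₁ : ρ < 1) :
    ∫ x, (Set.Ioi (0 : ℝ)).indicator (deriv (meanCutoff ρ)) x = -1 := by
  have hc : HasCompactSupport (meanCutoff ρ) :=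
    HasCompactSupport.intro (isCompact_Icc (a := -1) (b := 1)) fun x hx => by
      refine meanCutoff_eq_zero hρ₀ ?_
      by_contra! hlt
      exact hx (abs_le.1 ((sq_lt_one_iff_abs_lt_one x).1 hlt).le)
  have hdc : Continuous (deriv (meanCutoff ρ)) :=
    (contDiff_meanCutoff ρ).continuous_deriv (by simp)
  rw [integral_indicator measurableSet_Ioi, integral_Ioi_of_hasDerivAt_of_tendsto' (m := 0)
    (f := meanCutoff ρ) (fun x _ =>
      ((contDiff_meanCutoff ρ).differentiable (by simp) x).hasDerivAt)
    (hdc.integrable_of_hasCompactSupport hc.deriv).integrableOn]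
  · rw [meanCutoff_eq_one hρ₀ (by norm_num; linarith)]; norm_num
  · refine tendsto_const_nhds.congr' ?_
    filter_upwards [Filter.eventually_ge_atTop (1 : ℝ)] with x hx
    exact (meanCutoff_eq_zero hρ₀ (by nlinarith)).symm

/-- The profile of the test flow in the fluctuations. -/
def flowProfile (N : ℕ) [NeZero N] (γ ε : ℝ) (v : EuclideanSpace ℝ (ZMod N)) : ℝ :=
  Real.smoothTransition (2 - 2 * secondMoment v / √ε) *
    Real.exp (-(3 / 4 * fourthMoment v / ε)) * fluctWeight N γ ε v

theorem contDiff_flowProfile (γ ε : ℝ) :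
    ContDiff ℝ ((⊤ : ℕ∞) : WithTop ℕ∞) (flowProfile N γ ε) := by
  have h : ContDiff ℝ ((⊤ : ℕ∞) : WithTop ℕ∞) fun v : EuclideanSpace ℝ (ZMod N) =>
      Real.smoothTransition (2 - 2 * secondMoment v / √ε) := by
    refine Real.smoothTransition.contDiff.comp ?_
    unfold secondMoment; fun_prop
  unfold flowProfile
  refine (h.mul ?_).mul ?_
  · unfold fourthMoment; fun_prop
  · unfold fluctWeight hessianForm; fun_prop

theorem fluctWeight_pos (γ ε : ℝ) (v : EuclideanSpace ℝ (ZMod N)) : 0 < fluctWeight N γ ε v :=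
  Real.exp_pos _

theorem flowProfile_nonneg (γ ε : ℝ) (v : EuclideanSpace ℝ (ZMod N)) :
    0 ≤ flowProfile N γ ε v :=
  mul_nonneg (mul_nonneg (Real.smoothTransition.nonneg _) (Real.exp_pos _).le)
    (fluctWeight_pos γ ε v).le

theorem secondMoment_lt_of_flowProfile_ne_zero {γ ε : ℝ} (hε : 0 < ε)
    {v : EuclideanSpace ℝ (ZMod N)} (hv : flowProfile N γ ε v ≠ 0) : secondMoment v < √ε := by
  have hδ := Real.sqrt_pos.2 hε
  by_contra! hle
  apply hv
  have h1 : 2 - 2 * secondMoment v / √ε ≤ 0 := by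
    rw [sub_nonpos, le_div_iff₀ hδ]; linarith
  rw [flowProfile, Real.smoothTransition.zero_of_nonpos h1]; simp

theorem flowProfile_le_fluctWeight (γ : ℝ) {ε : ℝ} (hε : 0 < ε)
    (v : EuclideanSpace ℝ (ZMod N)) : flowProfile N γ ε v ≤ fluctWeight N γ ε v := by
  refine mul_le_of_le_one_left (fluctWeight_pos γ ε v).le ?_
  refine mul_le_one₀ (Real.smoothTransition.le_one _) (Real.exp_pos _).le ?_
  rw [Real.exp_le_one_iff, neg_nonpos]
  have := fourthMoment_nonneg v
  positivity

theorem fluctWeight_mul_le_flowProfile (γ : ℝ) {ε : ℝ} (hε : 0 < ε)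
    (v : EuclideanSpace ℝ (ZMod N)) :
    fluctWeight N γ ε v * (1 - 5 / ε * fourthMoment v) ≤ flowProfile N γ ε v := by
  have hδ := Real.sqrt_pos.2 hε
  have hsq : √ε ^ 2 = ε := Real.sq_sqrt hε.le
  have hw := fluctWeight_pos γ ε v
  have h4 := fourthMoment_nonneg v
  rcases le_or_gt (secondMoment v) (√ε / 2) with h | h
  · have h1 : 1 ≤ 2 - 2 * secondMoment v / √ε := by
      have : 2 * secondMoment v / √ε ≤ 1 := by rw [div_le_iff₀ hδ]; linarith
      linarith
    rw [flowProfile, Real.smoothTransition.one_of_one_le h1, one_mul, mul_comm]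
    gcongr
    have h2 := Real.add_one_le_exp (-(3 / 4 * fourthMoment v / ε))
    have h3 : 3 / 4 * fourthMoment v / ε ≤ 5 / ε * fourthMoment v := by
      rw [show 5 / ε * fourthMoment v = 5 * fourthMoment v / ε by ring]
      exact div_le_div_of_nonneg_right (by linarith) hε.le
    linarith
  · refine le_trans (mul_nonpos_of_nonneg_of_nonpos hw.le ?_) (flowProfile_nonneg γ ε v)
    have h2 := sq_secondMoment_le v
    have h3 : ε / 4 ≤ fourthMoment v := by nlinarith
    rw [sub_nonpos, div_mul_eq_mul_div, le_div_iff₀ hε]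
    linarith

theorem integrable_flowProfile (hN : 2 ≤ N) {μ ε : ℝ} (hμ : 1 < μ) (hε : 0 < ε) :
    Integrable (flowProfile N (μ * couplingThreshold N) ε) (fluctMeasure N) := by
  refine (integrable_fluctWeight hN hμ hε).mono'
    (contDiff_flowProfile _ _).continuous.aestronglyMeasurable
    (Filter.Eventually.of_forall fun v => ?_)
  rw [Real.norm_of_nonneg (flowProfile_nonneg _ _ v)]
  exact flowProfile_le_fluctWeight _ hε v

theorem le_sqrt_mul_integral_flowProfile (hN : 2 ≤ N) {μ ε : ℝ} (hμ : 1 < μ) (hε : 0 < ε) :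
    gaussMass N (μ * couplingThreshold N) ε *
        (1 - 240 * Real.exp (2 * Real.pi ^ 2 / (μ - 1)) * ε) ≤
      √(2 * Real.pi * ε) *
        ∫ v, flowProfile N (μ * couplingThreshold N) ε v ∂(fluctMeasure N) := by
  set γ := μ * couplingThreshold N
  rw [← integral_exp_neg_sq_div hε, ← integral_mean_mul_fluct]
  obtain ⟨i4, b4⟩ := integral_fourthMoment_le (N := N) hN hμ hε
  have i0 : Integrable fun u => Real.exp (-(1 / (2 * ε)) * mean N u ^ 2) *
      fluctWeight N γ ε (fluct u) :=
    integrable_mean_mul_fluct (integrable_exp_neg_sq_div hε) (integrable_fluctWeight hN hμ hε)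
  have i1 : Integrable fun u => Real.exp (-(1 / (2 * ε)) * mean N u ^ 2) *
      flowProfile N γ ε (fluct u) :=
    integrable_mean_mul_fluct (integrable_exp_neg_sq_div hε) (integrable_flowProfile hN hμ hε)
  refine le_trans ?_ (integral_mono (i0.sub (i4.const_mul (5 / ε))) i1 fun u => ?_)
  · rw [integral_sub' i0 (i4.const_mul (5 / ε)), integral_const_mul,
      integral_exp_mul_fluctWeight hN hμ hε]
    have : 5 / ε * ∫ u, (Real.exp (-(1 / (2 * ε)) * mean N u ^ 2) *
        fluctWeight N γ ε (fluct u)) * fourthMoment (fluct u) ≤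
        5 / ε * (48 * Real.exp (2 * Real.pi ^ 2 / (μ - 1)) * ε ^ 2 * gaussMass N γ ε) := by
      gcongr
    rw [show 5 / ε * (48 * Real.exp (2 * Real.pi ^ 2 / (μ - 1)) * ε ^ 2 * gaussMass N γ ε) =
      gaussMass N γ ε * (240 * Real.exp (2 * Real.pi ^ 2 / (μ - 1)) * ε) by
        field_simp; ring] at this
    linarith
  · have h := fluctWeight_mul_le_flowProfile γ hε (fluct u)
    calc _ = Real.exp (-(1 / (2 * ε)) * mean N u ^ 2) *
          (fluctWeight N γ ε (fluct u) * (1 - 5 / ε * fourthMoment (fluct u))) := by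
          simp only [Pi.sub_apply]; ring
      _ ≤ _ := by gcongr

/-- The test flow along the constant direction. -/
def testFlow (N : ℕ) [NeZero N] (γ ε ρ : ℝ) (u : EuclideanSpace ℝ (ZMod N)) : ℝ :=
  meanCutoff ρ (mean N u) * flowProfile N γ ε (fluct u)

theorem contDiff_testFlow (γ ε ρ : ℝ) :
    ContDiff ℝ ((⊤ : ℕ∞) : WithTop ℕ∞) (testFlow N γ ε ρ) :=
  ((contDiff_meanCutoff ρ).comp (mean N).contDiff).mul
    ((contDiff_flowProfile γ ε).comp contDiff_fluct)

theorem hasCompactSupport_testFlow (γ : ℝ) {ε ρ : ℝ} (hε : 0 < ε) (hρ : 0 < ρ) :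
    HasCompactSupport (testFlow N γ ε ρ) := by
  refine HasCompactSupport.intro
    (isCompact_closedBall (0 : EuclideanSpace ℝ (ZMod N)) (√(N * (1 + √ε)))) fun u hu => ?_
  by_contra hne
  obtain ⟨h1, h2⟩ := mul_ne_zero_iff.1 hne
  apply hu
  rw [mem_closedBall_zero_iff]
  refine Real.le_sqrt_of_sq_le ?_
  rw [norm_sq_eq]
  have h3 := (secondMoment_lt_of_flowProfile_ne_zero hε h2).le
  have h4 : mean N u ^ 2 ≤ 1 := by
    by_contra! hlt
    exact h1 (meanCutoff_eq_zero hρ hlt.le)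
  gcongr

theorem fderiv_testFlow (γ ε ρ : ℝ) (u : EuclideanSpace ℝ (ZMod N)) :
    fderiv ℝ (testFlow N γ ε ρ) u (constConfig N 1) =
      deriv (meanCutoff ρ) (mean N u) * flowProfile N γ ε (fluct u) := by
  have h1 : HasFDerivAt (fun u => meanCutoff ρ (mean N u))
      (deriv (meanCutoff ρ) (mean N u) • mean N) u :=
    ((contDiff_meanCutoff ρ).differentiable (by simp) _).hasDerivAt.comp_hasFDerivAt u
      (mean N).hasFDerivAt
  let L : EuclideanSpace ℝ (ZMod N) →L[ℝ] EuclideanSpace ℝ (ZMod N) :=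
    ContinuousLinearMap.id ℝ _ - (mean N).smulRight (constConfig N 1)
  have hL : ∀ u, L u = fluct u := fun u => rfl
  have hL1 : L (constConfig N 1) = 0 := by simp [L, mean_constConfig]
  have h2 : HasFDerivAt (fun u => flowProfile N γ ε (fluct u))
      ((fderiv ℝ (flowProfile N γ ε) (fluct u)).comp L) u :=
    (((contDiff_flowProfile γ ε).differentiable (by simp) (L u)).hasFDerivAt).comp u L.hasFDerivAt
  have h3 : HasFDerivAt (testFlow N γ ε ρ) _ u := h1.mul h2
  rw [h3.fderiv]
  simp [hL1, mean_constConfig, mul_comm]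

theorem integral_testFlow_inner {γ ε ρ : ℝ} (hε : 0 < ε) (hρ₀ : 0 < ρ)
    (hρ₁ : ρ < 1) (hδ : √ε ≤ ρ ^ 2 / 2)
    {h : EuclideanSpace ℝ (ZMod N) → ℝ} {g : EuclideanSpace ℝ (ZMod N) → EuclideanSpace ℝ (ZMod N)}
    (hadm : IsAdmissible (rescaledPotential N γ) ε
      (Metric.ball (constConfig N 1) (ρ * √(N : ℝ)))
      (Metric.ball (constConfig N (-1)) (ρ * √(N : ℝ))) h g) :
    ∫ u, testFlow N γ ε ρ u * inner ℝ (g u) (constConfig N 1) =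
      ∫ v, flowProfile N γ ε v ∂(fluctMeasure N) := by
  have h1 := hadm.isWeakGradient.integral_eq _ (contDiff_testFlow γ ε ρ)
    (hasCompactSupport_testFlow γ hε hρ₀) (constConfig N 1)
  have h2 : ∫ u, h u * fderiv ℝ (testFlow N γ ε ρ) u (constConfig N 1) =
      ∫ u, (Set.Ioi (0 : ℝ)).indicator (deriv (meanCutoff ρ)) (mean N u) *
        flowProfile N γ ε (fluct u) := by
    refine integral_congr_ae (Filter.Eventually.of_forall fun u => ?_)
    simp only [fderiv_testFlow]
    by_cases hk : flowProfile N γ ε (fluct u) = 0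
    · simp [hk]
    by_cases hd : deriv (meanCutoff ρ) (mean N u) = 0
    · simp [hd, Set.indicator_apply]
    have hm := secondMoment_lt_of_flowProfile_ne_zero hε hk
    obtain ⟨hz1, hz2⟩ := mem_of_deriv_meanCutoff_ne_zero hρ₀ hd
    have habs := abs_le_one_iff_mul_self_le_one.2 (by nlinarith : mean N u * mean N u ≤ 1)
    rw [abs_le] at habs
    rcases lt_or_ge 0 (mean N u) with hpos | hneg
    · rw [Set.indicator_of_mem (Set.mem_Ioi.2 hpos), hadm.eq_one u, one_mul]
      rw [mem_ball_constConfig_iff hρ₀]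
      have : 1 - ρ / 2 ≤ mean N u := by nlinarith
      nlinarith
    · rw [Set.indicator_of_notMem (by simpa using hneg), hadm.eq_zero u, zero_mul, zero_mul]
      rw [mem_ball_constConfig_iff hρ₀]
      have : mean N u ≤ -(1 - ρ / 2) := by nlinarith
      nlinarith
  rw [h2, integral_mean_mul_fluct, integral_deriv_meanCutoff hρ₀ hρ₁] at h1
  linarith

theorem integral_exp_mul_testFlow_sq_le (hN : 2 ≤ N) {μ ε ρ : ℝ} (hμ : 1 < μ) (hε : 0 < ε)
    (hρ : 0 < ρ) :
    ∫ u, Real.exp (rescaledPotential N (μ * couplingThreshold N) u / ε) *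
        testFlow N (μ * couplingThreshold N) ε ρ u ^ 2 ≤
      (∫ x, barrierWeight ε x) *
        ∫ v, flowProfile N (μ * couplingThreshold N) ε v ∂(fluctMeasure N) := by
  have hN0 := natCast_pos_of_neZero N
  set γ := μ * couplingThreshold N
  rw [← integral_mean_mul_fluct]
  refine integral_mono_of_nonneg (Filter.Eventually.of_forall fun u => by positivity)
    (integrable_mean_mul_fluct (integrable_barrierWeight ε) (integrable_flowProfile hN hμ hε))
    (Filter.Eventually.of_forall fun u => ?_)
  simp only
  have hk0 := flowProfile_nonneg γ ε (fluct u)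
  by_cases hne : testFlow N γ ε ρ u = 0
  · rw [hne]
    simpa using mul_nonneg (barrierWeight_nonneg ε _) hk0
  obtain ⟨h1, h2⟩ := mul_ne_zero_iff.1 hne
  have hm := (secondMoment_lt_of_flowProfile_ne_zero hε h2).le
  have hz : mean N u ^ 2 ≤ 1 := by
    by_contra! hlt
    exact h1 (meanCutoff_eq_zero hρ hlt.le)
  have habs := abs_le_one_iff_mul_self_le_one.2 (by nlinarith : mean N u * mean N u ≤ 1)
  rw [abs_le] at habs
  rw [barrierWeight, Set.indicator_of_mem (Set.mem_Icc.2 habs)]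
  set z := mean N u
  set v := fluct u
  set w := fluctWeight N γ ε v with hw
  set b := Real.exp (-(3 / 4 * fourthMoment v / ε)) with hb
  have hw0 : 0 < w := Real.exp_pos _
  have hb0 : 0 < b := Real.exp_pos _
  have hG : Real.exp (rescaledPotential N γ u / ε) * (b * w) ≤
      Real.exp ((doubleWell z + 2 * z ^ 2 * √ε) / ε) := by
    rw [hb, hw, fluctWeight, ← Real.exp_add, ← Real.exp_add, Real.exp_le_exp]
    have hle := rescaledPotential_le γ u
    rw [show rescaledPotential N γ u / ε + (-(3 / 4 * fourthMoment v / ε) +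
      -(hessianForm N γ v / (2 * N * ε))) = (rescaledPotential N γ u - 3 / 4 * fourthMoment v -
        hessianForm N γ v / (2 * N)) / ε by field_simp; ring]
    have h3 : 2 * z ^ 2 * secondMoment v ≤ 2 * z ^ 2 * √ε := by gcongr
    gcongr
    linarith
  set η := meanCutoff ρ z
  set χ := Real.smoothTransition (2 - 2 * secondMoment v / √ε)
  have hη0 : 0 ≤ η := Real.smoothTransition.nonneg _
  have hη1 : η ≤ 1 := Real.smoothTransition.le_one _
  have hχ0 : 0 ≤ χ := Real.smoothTransition.nonneg _
  have hχ1 : χ ≤ 1 := Real.smoothTransition.le_one _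
  have hk : flowProfile N γ ε v = χ * b * w := rfl
  have hφ : testFlow N γ ε ρ u = η * (χ * b * w) := rfl
  rw [hφ, hk]
  calc Real.exp (rescaledPotential N γ u / ε) * (η * (χ * b * w)) ^ 2
      = (Real.exp (rescaledPotential N γ u / ε) * (b * w)) * (χ * b * w) * (η * η * χ) := by ring
    _ ≤ Real.exp ((doubleWell z + 2 * z ^ 2 * √ε) / ε) * (χ * b * w) * (1 * 1 * 1) := by gcongr
    _ = _ := by ring

theorem le_dirichletForm (hN : 2 ≤ N) {μ ε ρ : ℝ} (hμ : 1 < μ) (hε : 0 < ε) (hρ₀ : 0 < ρ)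
    (hρ₁ : ρ < 1) (hδ : √ε ≤ ρ ^ 2 / 2) (hδ' : √ε ≤ 1 / 16)
    (hc : 240 * Real.exp (2 * Real.pi ^ 2 / (μ - 1)) * ε ≤ 1)
    {h : EuclideanSpace ℝ (ZMod N) → ℝ} {g : EuclideanSpace ℝ (ZMod N) → EuclideanSpace ℝ (ZMod N)}
    (hadm : IsAdmissible (rescaledPotential N (μ * couplingThreshold N)) ε
      (Metric.ball (constConfig N 1) (ρ * √(N : ℝ)))
      (Metric.ball (constConfig N (-1)) (ρ * √(N : ℝ))) h g) :
    ε * gaussMass N (μ * couplingThreshold N) ε / (N * (2 * Real.pi * ε)) *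
        ((1 - 240 * Real.exp (2 * Real.pi ^ 2 / (μ - 1)) * ε) / (1 + 28 * √ε)) ≤
      dirichletForm (rescaledPotential N (μ * couplingThreshold N)) ε
        (Metric.ball (constConfig N 1) (ρ * √(N : ℝ)))
        (Metric.ball (constConfig N (-1)) (ρ * √(N : ℝ))) g := by
  have hN0 := natCast_pos_of_neZero N
  have hpi := Real.pi_pos
  have hI := integral_barrierWeight_le hε hδ'
  have hI0 := integral_barrierWeight_pos ε
  have hK := le_sqrt_mul_integral_flowProfile (N := N) hN hμ hε
  have hφg := integral_testFlow_inner hε hρ₀ hρ₁ hδ hadm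
  have hφφ := integral_exp_mul_testFlow_sq_le (N := N) hN hμ hε hρ₀
  have hgm := gaussMass_pos (N := N) hN hμ hε
  have hmain := two_mul_integral_le_dirichlet (continuous_rescaledPotential _) Metric.isOpen_ball
    Metric.isOpen_ball hadm (contDiff_testFlow (μ * couplingThreshold N) ε ρ).continuous
    (hasCompactSupport_testFlow _ hε hρ₀) (constConfig N 1) hI0
  rw [hφg, norm_constConfig_one_sq] at hmain
  rw [dirichletForm]
  set γ := μ * couplingThreshold N
  set I := ∫ x, barrierWeight ε x
  set K := ∫ v, flowProfile N γ ε v ∂(fluctMeasure N)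
  set z₀ := √(2 * Real.pi * ε)
  set c := 240 * Real.exp (2 * Real.pi ^ 2 / (μ - 1)) * ε
  set 𝒟 := ∫ u in (Metric.ball (constConfig N 1) (ρ * √(N : ℝ)) ∪
    Metric.ball (constConfig N (-1)) (ρ * √(N : ℝ)))ᶜ,
      Real.exp (-rescaledPotential N γ u / ε) * ‖g u‖ ^ 2
  have hz0 : 0 < z₀ := Real.sqrt_pos.2 (by positivity)
  have hz : 2 * Real.pi * ε = z₀ ^ 2 := (Real.sq_sqrt (by positivity)).symm
  have h1 : I⁻¹ * ∫ u, Real.exp (rescaledPotential N γ u / ε) * testFlow N γ ε ρ u ^ 2 ≤ K := by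
    rw [inv_mul_le_iff₀ hI0]; exact hφφ
  have h2 : K ≤ I * N * 𝒟 := by linarith
  have h3 : K / (N * I) ≤ 𝒟 := by
    rw [div_le_iff₀ (by positivity)]; linarith
  have hδ0 := Real.sqrt_nonneg ε
  have h4 : gaussMass N γ ε * (1 - c) / z₀ ≤ K := by
    rw [div_le_iff₀ hz0]; linarith
  have h5 : 0 ≤ gaussMass N γ ε * (1 - c) / z₀ :=
    div_nonneg (mul_nonneg hgm.le (by linarith)) hz0.le
  calc _ = ε * (gaussMass N γ ε * (1 - c) / z₀ / (N * (z₀ * (1 + 28 * √ε)))) := by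
        rw [hz]; field_simp
    _ ≤ ε * (K / (N * I)) := by gcongr; exact h5.trans h4
    _ ≤ ε * 𝒟 := by gcongr

end Lower

section Asymptotics

variable {N : ℕ} [NeZero N]

theorem gaussMass_div_eq (hN : 2 ≤ N) {μ ε : ℝ} (hμ : 1 < μ) (hε : 0 < ε) :
    ε * gaussMass N (μ * couplingThreshold N) ε / (N * (2 * Real.pi * ε)) =
      (N : ℝ) ^ ((N : ℝ) / 2 - 1) * (ε * √(2 * Real.pi * ε) ^ (N - 2) *
        (1 / √|(hessianMatrix (potential N (μ * couplingThreshold N)) 0).det|)) := by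
  have hN0 := natCast_pos_of_neZero N
  have hpi := Real.pi_pos
  have hdet := (posDef_flippedHessian (N := N) hN hμ).det_pos
  have h1 : |(hessianMatrix (potential N (μ * couplingThreshold N)) 0).det| =
      (flippedHessian N (μ * couplingThreshold N)).det := by
    rw [← abs_neg, ← det_flippedHessian, abs_of_pos hdet]
  have h2 : √(2 * Real.pi * (N * ε)) ^ N =
      (N : ℝ) ^ ((N : ℝ) / 2) * (√(2 * Real.pi * ε) ^ (N - 2) * (2 * Real.pi * ε)) := by
    rw [show 2 * Real.pi * (N * ε) = N * (2 * Real.pi * ε) by ring, Real.sqrt_mul hN0.le, mul_pow]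
    congr 1
    · rw [Real.sqrt_eq_rpow, ← Real.rpow_natCast ((N : ℝ) ^ (1 / 2 : ℝ)) N, ← Real.rpow_mul hN0.le]
      congr 1
      ring
    · have h3 := Real.sq_sqrt (by positivity : 0 ≤ 2 * Real.pi * ε)
      nth_rw 3 [← h3]
      rw [← pow_add, Nat.sub_add_cancel hN]
  have hd0 := (Real.sqrt_pos.2 hdet).ne'
  rw [h1, gaussMass, h2, Real.rpow_sub_one hN0.ne']
  field_simp

theorem capacity_bounds (hN : 2 ≤ N) {μ ε ρ : ℝ} (hμ : 1 < μ) (hε : 0 < ε) (hρ₀ : 0 < ρ)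
    (hρ₁ : ρ < 1) (hδ : √ε ≤ ρ ^ 2 / 2) (hδ' : √ε ≤ 1 / 16)
    (hc : 240 * Real.exp (2 * Real.pi ^ 2 / (μ - 1)) * ε ≤ 1)
    (hs : 6 * ε / (1 - ρ) ^ 2 < 1) :
    capacity (rescaledPotential N (μ * couplingThreshold N)) ε
        (Metric.ball (constConfig N 1) (ρ * √(N : ℝ)))
        (Metric.ball (constConfig N (-1)) (ρ * √(N : ℝ))) ∈
      Set.Icc (ε * gaussMass N (μ * couplingThreshold N) ε / (N * (2 * Real.pi * ε)) *
          ((1 - 240 * Real.exp (2 * Real.pi ^ 2 / (μ - 1)) * ε) / (1 + 28 * √ε)))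
        (ε * gaussMass N (μ * couplingThreshold N) ε / (N * (2 * Real.pi * ε)) *
          (1 / (1 - 6 * ε / (1 - ρ) ^ 2))) := by
  obtain ⟨⟨h, g, hadm⟩, hle⟩ := capacity_le (N := N) hN hμ hε hρ₀ hρ₁ hs
  refine ⟨le_csInf ⟨_, h, g, hadm, rfl⟩ ?_, hle⟩
  rintro _ ⟨h', g', hadm', rfl⟩
  exact le_dirichletForm hN hμ hε hρ₀ hρ₁ hδ hδ' hc hadm'

theorem sqrt_le_sqrt_mul_abs_log_pow {ε : ℝ} (hε : 0 < ε) (hε' : ε ≤ Real.exp (-1)) :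
    √ε ≤ √(ε * |Real.log ε| ^ 3) := by
  have h1 : Real.log ε ≤ -1 := (Real.log_le_iff_le_exp hε).2 hε'
  have h2 : 1 ≤ |Real.log ε| := by rw [abs_of_nonpos (by linarith)]; linarith
  exact Real.sqrt_le_sqrt (le_mul_of_one_le_right hε.le (one_le_pow₀ h2))

end Asymptotics

end CoupledChain

end

theorem proposition4p1 (μ ρ : ℝ) (hμ : 1 < μ) (hρ₀ : 0 < ρ) (hρ₁ : ρ < 1) :
    ∃ A ε₀ : ℝ, 0 < ε₀ ∧ ∀ (N : ℕ) [NeZero N], 2 ≤ N → ∀ ε : ℝ, 0 < ε → ε < ε₀ →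
      ∃ R : ℝ, |R| ≤ A * √(ε * |Real.log ε| ^ 3) ∧
        CoupledChain.capacity
            (CoupledChain.rescaledPotential N (μ * CoupledChain.couplingThreshold N)) ε
            (Metric.ball (CoupledChain.constConfig N 1) (ρ * √(N : ℝ)))
            (Metric.ball (CoupledChain.constConfig N (-1)) (ρ * √(N : ℝ))) /
          (N : ℝ) ^ ((N : ℝ) / 2 - 1) =
        ε * √(2 * Real.pi * ε) ^ (N - 2) *
          (1 / √|(CoupledChain.hessianMatrix
            (CoupledChain.potential N (μ * CoupledChain.couplingThreshold N)) 0).det|) *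
          (1 + R) := by
  set c : ℝ := 240 * Real.exp (2 * Real.pi ^ 2 / (μ - 1)) with hc
  set a : ℝ := 1 - ρ with ha
  have ha0 : 0 < a := by linarith
  have hc0 : 0 < c := by positivity
  refine ⟨c + 28 + 12 / a ^ 2, min (min ((ρ ^ 2 / 2) ^ 2) ((1 / 16) ^ 2))
    (min (min (1 / c) (a ^ 2 / 12)) (Real.exp (-1))), by positivity, ?_⟩
  intro N _ hN ε hε hlt
  simp only [lt_min_iff] at hlt
  obtain ⟨⟨h1, h2⟩, ⟨h3, h4⟩, h5⟩ := hlt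
  have hδ0 : 0 < √ε := Real.sqrt_pos.2 hε
  have hδ1 : √ε ≤ ρ ^ 2 / 2 := (Real.sqrt_le_left (by positivity)).2 h1.le
  have hδ2 : √ε ≤ 1 / 16 := (Real.sqrt_le_left (by positivity)).2 h2.le
  have hcε : c * ε ≤ 1 := by
    rw [lt_div_iff₀ hc0] at h3; linarith
  have hsa : 6 * ε / a ^ 2 ≤ 1 / 2 := by
    rw [div_le_iff₀ (by positivity)]; linarith
  have hεδ : ε ≤ √ε := by
    nlinarith [Real.sq_sqrt hε.le]
  have hlog := CoupledChain.sqrt_le_sqrt_mul_abs_log_pow hε h5.le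
  obtain ⟨hlow, hup⟩ := CoupledChain.capacity_bounds (N := N) hN hμ hε hρ₀ hρ₁ hδ1 hδ2 hcε
    (by linarith)
  have hgm := CoupledChain.gaussMass_pos (N := N) hN hμ hε
  have hN0 := CoupledChain.natCast_pos_of_neZero N
  have hT : 0 < ε * CoupledChain.gaussMass N (μ * CoupledChain.couplingThreshold N) ε /
    (N * (2 * Real.pi * ε)) := by have := Real.pi_pos; positivity
  have hrp : 0 < (N : ℝ) ^ ((N : ℝ) / 2 - 1) := Real.rpow_pos_of_pos hN0 _
  rw [CoupledChain.gaussMass_div_eq hN hμ hε] at hlow hup hT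
  set T := ε * √(2 * Real.pi * ε) ^ (N - 2) * (1 / √|(CoupledChain.hessianMatrix
    (CoupledChain.potential N (μ * CoupledChain.couplingThreshold N)) 0).det|)
  set C := CoupledChain.capacity
    (CoupledChain.rescaledPotential N (μ * CoupledChain.couplingThreshold N)) ε
    (Metric.ball (CoupledChain.constConfig N 1) (ρ * √(N : ℝ)))
    (Metric.ball (CoupledChain.constConfig N (-1)) (ρ * √(N : ℝ)))
  set P := (N : ℝ) ^ ((N : ℝ) / 2 - 1)
  have hT0 : 0 < T := (mul_pos_iff_of_pos_left hrp).1 hT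
  have hlow' : 1 - (c + 28) * √ε ≤ (1 - c * ε) / (1 + 28 * √ε) := by
    rw [le_div_iff₀ (by positivity)]
    nlinarith [mul_nonneg hc0.le (sub_nonneg.2 hεδ), mul_pos hδ0 hδ0,
      mul_nonneg hc0.le (mul_pos hδ0 hδ0).le]
  have hup' : 1 / (1 - 6 * ε / a ^ 2) ≤ 1 + 12 / a ^ 2 * √ε := by
    have h6 : 1 / (1 - 6 * ε / a ^ 2) ≤ 1 + 2 * (6 * ε / a ^ 2) := by
      have : 0 ≤ 6 * ε / a ^ 2 := by positivity
      rw [div_le_iff₀ (by linarith)]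
      nlinarith
    have h7 : 12 / a ^ 2 * ε ≤ 12 / a ^ 2 * √ε := by gcongr
    calc _ ≤ _ := h6
      _ = 1 + 12 / a ^ 2 * ε := by ring
      _ ≤ _ := by linarith
  have hCl : 1 - (c + 28) * √ε ≤ C / (P * T) := by
    rw [le_div_iff₀ hT, mul_comm]
    exact (mul_le_mul_of_nonneg_left hlow' hT.le).trans hlow
  have hCu : C / (P * T) ≤ 1 + 12 / a ^ 2 * √ε := by
    rw [div_le_iff₀ hT, mul_comm]
    exact hup.trans (mul_le_mul_of_nonneg_left hup' hT.le)
  have ha2 : 0 < 12 / a ^ 2 := by positivity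
  refine ⟨C / (P * T) - 1, ?_, by field_simp; ring⟩
  refine le_trans ?_ (mul_le_mul_of_nonneg_left hlog (by positivity))
  rw [abs_le]
  constructor <;> nlinarith [mul_pos ha2 hδ0, mul_pos hc0 hδ0]
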